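/- Let $d\ge 0$ and $0\le m\le d$ be integers and let $S$ be a symmetric real $d\times d$ matrix of full rank with exactly $m$ positive eigenvalues; write $S(x,y)=\langle x,Sy\rangle$ for $x,y\in\mathbb{R}^d$. A set $G\subset\mathbb{R}^d$ is $S$-monotone if $S(x-y,x-y)\ge 0$ for all $x,y\in G$; let $\mathcal{M}(S)$ be the family of $S$-monotone sets that are maximal with respect to inclusion. For $G\in\mathcal{M}(S)$ and $y\in\mathbb{R}^d$ put $$\psi_G(y)=\sup_{x\in G}\Bigl(S(x,y)-\tfrac12 S(x,x)\Bigr)\in(-\infty,\infty],\qquad P_G(y)=\operatorname*{arg\,min}_{x\in G}S(x-y,x-y)\subset G,$$ $$\Sigma(P_G)=\{y: P_G(y)\neq\emptyset \text{ and } P_G(y)\text{ is not a singleton}\}.$$ Let $(\Omega,\mathcal{F},\mathbb{P})$ be a probability space, let $Y$ be an $\mathbb{R}^d$-valued random variable with $\mathbb{E}|Y|^2<\infty$, and let $\nu$ be its law. Consider: (i) the map problem: maximize $\tfrac12\mathbb{E}[S(X,Y)]$ over the square-integrable $\mathbb{R}^d$-valued random variables $X$ such that $X=f(Y)$ a.s.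 for some Borel function $f$ and $\mathbb{E}[Y\mid X]=X$ a.s.; (ii) the plan problem: maximize $\tfrac12\int S(x,y)\,d\gamma(x,y)$ over the Borel probability measures $\gamma$ on $\mathbb{R}^d\times\mathbb{R}^d$ with finite second moment, second marginal $\nu$ and $\gamma(y\mid x)=x$ (that is, the conditional expectation under $\gamma$ of the second coordinate given the first one is the first coordinate, $\gamma$-a.s.); (iii) the dual problem: minimize $\mathbb{E}[\psi_G(Y)]$ over $G\in\mathcal{M}(S)$. Let $G\in\mathcal{M}(S)$ be optimal for (iii) and assume that $Y\notin\Sigma(P_G)$ a.s. Then $P_G(Y)$ is a.s. a singleton. Let $X$ be its unique element where it is a singleton, and $X=0$ elsewhere. Then $X$ is an optimal map for (i), every optimal map for (i) equals $X$ a.s., and the law of $(X,Y)$ is the one and only optimal plan for (ii). -/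

import Mathlib

open MeasureTheory

noncomputable section

namespace BackwardTransport

/-- The Euclidean space of dimension `d`. -/
abbrev Space (d : ℕ) : Type := EuclideanSpace ℝ (Fin d)

/-- Symmetric `d × d` real matrices of full rank with exactly `m` positive eigenvalues
(counted with multiplicity). -/
def symMatrices (d m : ℕ) : Set (Matrix (Fin d) (Fin d) ℝ) :=
  {S | ∃ h : S.IsHermitian, S.rank = d ∧ {i | 0 < h.eigenvalues i}.ncard = m}

/-- The bilinear form `S(x, y) = ⟨x, S y⟩`. -/
def form {d : ℕ} (S : Matrix (Fin d) (Fin d) ℝ) (x y : Space d) : ℝ :=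
  ∑ i, ∑ j, x i * S i j * y j

/-- `S`-monotone sets. -/
def IsSMonotone {d : ℕ} (S : Matrix (Fin d) (Fin d) ℝ) (G : Set (Space d)) : Prop :=
  ∀ x ∈ G, ∀ y ∈ G, 0 ≤ form S (x - y) (x - y)

/-- The family of maximal `S`-monotone sets. -/
def maximalMonotoneSets {d : ℕ} (S : Matrix (Fin d) (Fin d) ℝ) : Set (Set (Space d)) :=
  {G | Maximal (IsSMonotone S) G}

/-- The Fitzpatrick function of `G` in the `S`-space, with extended real values. -/
def fitzpatrick {d : ℕ} (S : Matrix (Fin d) (Fin d) ℝ) (G : Set (Space d)) (y : Space d) : EReal :=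
  ⨆ x ∈ G, ((form S x y - (1 / 2) * form S x x : ℝ) : EReal)

/-- The projection multifunction on `G` in the `S`-space. -/
def proj {d : ℕ} (S : Matrix (Fin d) (Fin d) ℝ) (G : Set (Space d)) (y : Space d) :
    Set (Space d) :=
  {x | x ∈ G ∧ ∀ z ∈ G, form S (x - y) (x - y) ≤ form S (z - y) (z - y)}

/-- The singular set of the projection: the points of its domain where it is not a singleton. -/
def singularSet {d : ℕ} (S : Matrix (Fin d) (Fin d) ℝ) (G : Set (Space d)) : Set (Space d) :=
  {y | (proj S G y).Nonempty ∧ ¬ ∃ x, proj S G y = {x}}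

open Classical in
/-- The function `y ↦ P_G(y)` where the projection is a singleton, and `0` elsewhere. -/
def projFun {d : ℕ} (S : Matrix (Fin d) (Fin d) ℝ) (G : Set (Space d)) (y : Space d) : Space d :=
  if h : ∃ x, proj S G y = {x} then h.choose else 0

/-- The expectation of an extended real function: the integral of its positive part minus
the integral of its negative part. For the Fitzpatrick function of a maximal `S`-monotone set
and a law with finite second moment the latter is finite, because
`ψ_G(y) ≥ S(y, y) / 2`. -/
def extExpectation {α : Type*} [MeasurableSpace α] (μ : Measure α) (f : α → EReal) : EReal :=
  ((∫⁻ a, (f a).toENNReal ∂μ : ENNReal) : EReal) - ((∫⁻ a, (-f a).toENNReal ∂μ : ENNReal) : EReal)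

/-- `G` minimizes `∫ ψ_G dν` over the maximal `S`-monotone sets. -/
def IsDualOptimal {d : ℕ} (S : Matrix (Fin d) (Fin d) ℝ) (ν : Measure (Space d))
    (G : Set (Space d)) : Prop :=
  G ∈ maximalMonotoneSets S ∧ ∀ H ∈ maximalMonotoneSets S,
    extExpectation ν (fitzpatrick S G) ≤ extExpectation ν (fitzpatrick S H)

/-- The feasible maps: square-integrable random variables `X` that are `Y`-measurable
(`X = f(Y)` almost surely for a Borel function `f`) and satisfy `E[Y | X] = X`. -/
def feasibleMaps {d : ℕ} {Ω : Type*} [MeasurableSpace Ω] (P : Measure Ω) (Y : Ω → Space d) :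
    Set (Ω → Space d) :=
  {X | Measurable X ∧ MemLp X 2 P ∧
    (∃ f : Space d → Space d, Measurable f ∧ X =ᵐ[P] fun ω => f (Y ω)) ∧
    P[Y | MeasurableSpace.comap X inferInstance] =ᵐ[P] X}

/-- `X` maximizes `E[S(X, Y)] / 2` over the feasible maps. -/
def IsOptimalMap {d : ℕ} (S : Matrix (Fin d) (Fin d) ℝ) {Ω : Type*} [MeasurableSpace Ω]
    (P : Measure Ω) (Y X : Ω → Space d) : Prop :=
  X ∈ feasibleMaps P Y ∧ ∀ Z ∈ feasibleMaps P Y,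
    (1 / 2) * ∫ ω, form S (Z ω) (Y ω) ∂P ≤ (1 / 2) * ∫ ω, form S (X ω) (Y ω) ∂P

/-- The feasible plans: Borel probability measures `γ(dx, dy)` with finite second moment,
second marginal `ν` and `γ(y | x) = x`. (The norm of the product is equivalent to the
Euclidean one, so that finiteness of the second moment is the usual one.) -/
def feasiblePlans {d : ℕ} (ν : Measure (Space d)) : Set (Measure (Space d × Space d)) :=
  {γ | IsProbabilityMeasure γ ∧ MemLp (fun p : Space d × Space d => p) 2 γ ∧
    γ.map Prod.snd = ν ∧
    γ[(Prod.snd : Space d × Space d → Space d) |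
      MeasurableSpace.comap Prod.fst inferInstance] =ᵐ[γ] Prod.fst}

/-- `γ` maximizes `∫ S(x, y) dγ / 2` over the feasible plans. -/
def IsOptimalPlan {d : ℕ} (S : Matrix (Fin d) (Fin d) ℝ) (ν : Measure (Space d))
    (γ : Measure (Space d × Space d)) : Prop :=
  γ ∈ feasiblePlans ν ∧ ∀ η ∈ feasiblePlans ν,
    (1 / 2) * ∫ p, form S p.1 p.2 ∂η ≤ (1 / 2) * ∫ p, form S p.1 p.2 ∂γ

end BackwardTransport

end

/-!
The theorem follows from a duality without gap between the plan problem and the dual problem, in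
which complementary slackness identifies the optimal plan.

*Slackness.* Let `J` be the involution that is `1` on the positive and `-1` on the negative
eigenspace of `S`. A maximal `S`-monotone set `G` meets every translate of the negative eigenspace
in exactly one point (Minty's parametrization), so that there is a Lipschitz map `f` into `G` with
`S(f x - x, f x - x) ≤ 0`, with equality only if `f x = x` (`exists_lipschitz_selection`). For a
plan `γ` with `γ(y | x) = x`, integration of `ψ_G(y) ≥ S(f x, y) - S(f x, f x) / 2` gives
`∫ ψ_G dν ≥ ∫ S(x, y) dγ / 2 - ∫ S(f x - x, f x - x) dγ / 2 ≥ ∫ S(x, y) dγ / 2`. In the case of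
equality `x = f x` is in `G` and attains the supremum in `ψ_G(y)`, that is, `x ∈ P_G(y)` for
`γ`-almost every `(x, y)` (`IsMartingalePlan.ae_mem_proj`).

*No gap.* An optimal plan exists (`exists_isOptimalPlan`): the set of plans is weakly compact, and
by Jensen's inequality the squares `‖x‖²` are uniformly integrable along it. If a small part of the
mass of an optimal plan is moved to its barycenter, the first variation of the value
(`IsOptimalPlan.first_variation`) shows that the pairs `(∫ ρ y dγ, ∫ ρ (S(x, y) - S(x, x) / 2) dγ)`,
with `ρ` a bounded probability density, form a convex set above the graph of `S(y, y) / 2`. A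
maximal convex set `C` above that graph touches it exactly over a maximal `S`-monotone set `H`
(`exists_monotone_of_convex`), and `ψ_H` is below `C`. Normalized indicator functions as `ρ` then
give `ψ_H(y) ≤ S(x, y) - S(x, x) / 2` almost everywhere
(`IsOptimalPlan.exists_maximalMonotoneSet`), so that `∫ ψ_H dν` is at most the value of the plan.

*Conclusion.* If `G` is optimal for the dual problem, every optimal plan is carried by the graph of
`P_G`. As `P_G` is almost surely not multivalued, such a plan is the law of `(P_G(Y), Y)`. Hence
this law is the only optimal plan; its value bounds the values of the plans induced by maps, and it
is itself induced by a map.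
-/

namespace BackwardTransport

/-! ### The bilinear form of a matrix and its fundamental symmetry -/

section

open Matrix

/-- The bilinear form attached to a matrix, as a bundled bilinear map. -/
noncomputable def bilin {d : ℕ} (S : Matrix (Fin d) (Fin d) ℝ) : LinearMap.BilinForm ℝ (Space d) :=
  LinearMap.mk₂ ℝ (form S)
    (fun x y z => by simp [form, add_mul, Finset.sum_add_distrib])
    (fun c x y => by simp [form, Finset.mul_sum, mul_assoc])
    (fun x y z => by simp [form, mul_add, Finset.sum_add_distrib])
    (fun c x y => by
      simp only [form, PiLp.smul_apply, smul_eq_mul, Finset.mul_sum]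
      exact Finset.sum_congr rfl fun i _ => Finset.sum_congr rfl fun j _ => by ring)

theorem bilin_apply {d : ℕ} (S : Matrix (Fin d) (Fin d) ℝ) (x y : Space d) :
    bilin S x y = form S x y := rfl

theorem form_eq_inner {d : ℕ} (S : Matrix (Fin d) (Fin d) ℝ) (x y : Space d) :
    form S x y = inner ℝ x (WithLp.toLp 2 (S *ᵥ y.ofLp) : Space d) := by
  simp only [form, PiLp.inner_apply, mulVec, dotProduct]
  simp [Finset.mul_sum, mul_comm, mul_left_comm, mul_assoc]

theorem bilin_symm {d : ℕ} {S : Matrix (Fin d) (Fin d) ℝ} (hS : S.IsHermitian) (x y : Space d) :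
    bilin S x y = bilin S y x := by
  simp only [bilin_apply, form]
  rw [Finset.sum_comm]
  refine Finset.sum_congr rfl fun i _ => Finset.sum_congr rfl fun j _ => ?_
  have : S j i = S i j := by simpa using hS.apply i j
  rw [this]; ring

/-- A fundamental symmetry of a bilinear form `b`: an involution `J`, symmetric for `b`, such that
`(x, y) ↦ b (J x) y` is positive definite. Its eigenspaces for `1` and `-1` are complementary
`b`-orthogonal subspaces on which `b` is positive, respectively negative, definite. -/
structure FundamentalSymmetry {E : Type*} [AddCommGroup E] [Module ℝ E]
    (b : LinearMap.BilinForm ℝ E) where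
  /-- The underlying linear map. -/
  J : E →ₗ[ℝ] E
  symm : ∀ x y, b x y = b y x
  invol : ∀ x, J (J x) = x
  adjoint : ∀ x y, b (J x) y = b x (J y)
  pos : ∀ x, x ≠ 0 → 0 < b (J x) x

/-- The fundamental symmetry that multiplies each vector of an orthonormal eigenbasis by the sign of
its eigenvalue. -/
theorem exists_fundamentalSymmetry {d m : ℕ} {S : Matrix (Fin d) (Fin d) ℝ}
    (hS : S ∈ symMatrices d m) : Nonempty (FundamentalSymmetry (bilin S)) := by
  obtain ⟨h, hr, -⟩ := hS
  have hne : ∀ i, h.eigenvalues i ≠ 0 := by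
    have h1 := h.rank_eq_card_non_zero_eigs
    rw [hr] at h1
    have h2 : Fintype.card {i // h.eigenvalues i ≠ 0} = Fintype.card (Fin d) := by simp [← h1]
    intro i
    by_contra hi
    have := Fintype.card_subtype_lt (p := fun i => h.eigenvalues i ≠ 0) (x := i) (by simpa using hi)
    omega
  let e := h.eigenvectorBasis
  let μ := h.eigenvalues
  have hb : ∀ x y, bilin S x y = ∑ i, μ i * (e.repr x i * e.repr y i) := by
    have key : ∀ (y : Space d) i, e.repr (WithLp.toLp 2 (S *ᵥ y.ofLp) : Space d) i
        = μ i * e.repr y i := by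
      intro y i
      have h1 := form_eq_inner S (e i) y
      rw [← bilin_apply, bilin_symm h, bilin_apply, form_eq_inner] at h1
      rw [e.repr_apply_apply, ← h1, e.repr_apply_apply]
      have h2 : (WithLp.toLp 2 (S *ᵥ (e i).ofLp) : Space d) = μ i • e i := by
        rw [h.mulVec_eigenvectorBasis i]; rfl
      rw [h2, inner_smul_right, real_inner_comm]
    intro x y
    rw [bilin_apply, form_eq_inner, ← e.repr.inner_map_map, PiLp.inner_apply]
    refine Finset.sum_congr rfl fun i _ => ?_
    rw [key]
    simp
    ring
  let J : Space d →ₗ[ℝ] Space d :=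
    { toFun := fun x => e.repr.symm (WithLp.toLp 2 fun i => SignType.sign (μ i) * e.repr x i)
      map_add' := by
        intro x y
        rw [← map_add]
        congr 1
        ext i
        simp [mul_add]
      map_smul' := by
        intro c x
        rw [← map_smul]
        congr 1
        ext i
        simp
        ring }
  have hJ : ∀ x i, e.repr (J x) i = SignType.sign (μ i) * e.repr x i := by
    intro x i
    simp [J]
  refine ⟨⟨J, bilin_symm h, fun x => ?_, fun x y => ?_, fun x hx => ?_⟩⟩
  · apply e.repr.injective
    ext i
    rw [hJ, hJ, ← mul_assoc]
    rcases (hne i).lt_or_gt with h1 | h1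
    · simp [μ, sign_neg h1]
    · simp [μ, sign_pos h1]
  · rw [hb, hb]
    refine Finset.sum_congr rfl fun i _ => ?_
    rw [hJ, hJ]; ring
  · rw [hb]
    have h3 : ∀ i, μ i * (e.repr (J x) i * e.repr x i) = |μ i| * (e.repr x i) ^ 2 := by
      intro i
      rw [hJ, ← sign_mul_self (μ i)]
      ring
    simp only [h3]
    apply Finset.sum_pos' (fun i _ => by positivity)
    by_contra hc
    push Not at hc
    apply hx
    apply e.repr.injective
    ext i
    by_contra h4
    have h5 : e.repr x i ≠ 0 := by simpa using h4
    have h6 := hc i (Finset.mem_univ i)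
    have h7 : 0 < |μ i| := abs_pos.2 (hne i)
    have : 0 < |μ i| * (e.repr x i) ^ 2 := by positivity
    linarith

end

/-! ### Convex sets above the graph of a quadratic form -/

section Convex

variable {E : Type*} [NormedAddCommGroup E] [NormedSpace ℝ E]
  {b : LinearMap.BilinForm ℝ E}

namespace FundamentalSymmetry

theorem J_eq_neg (F : FundamentalSymmetry b) {w : E} (h : b (w + F.J w) (w + F.J w) ≤ 0) :
    F.J w = -w := by
  by_contra hne
  have h1 : w + F.J w ≠ 0 := fun h0 => hne (eq_neg_of_add_eq_zero_right h0)
  have h2 := F.pos _ h1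
  rw [map_add F.J, F.invol, add_comm (F.J w)] at h2
  linarith

theorem eq_zero_of_J_eq_neg (F : FundamentalSymmetry b) {w : E} (hw : F.J w = -w) (h : 0 ≤ b w w) :
    w = 0 := by
  by_contra hne
  have h2 := F.pos _ hne
  rw [hw] at h2
  simp at h2
  linarith

theorem nonneg (F : FundamentalSymmetry b) (x : E) : 0 ≤ b (F.J x) x := by
  rcases eq_or_ne x 0 with rfl | h
  · simp
  · exact (F.pos x h).le

theorem apply_J_J (F : FundamentalSymmetry b) (x y : E) : b (F.J x) (F.J y) = b x y := by
  rw [F.adjoint, F.invol]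

theorem J_comm (F : FundamentalSymmetry b) (x y : E) : b (F.J x) y = b (F.J y) x := by
  rw [F.adjoint, F.symm]

theorem le_pos (F : FundamentalSymmetry b) (x : E) : b x x ≤ b (F.J x) x := by
  have h := F.nonneg (x - F.J x)
  simp only [map_sub, LinearMap.sub_apply, F.invol, F.apply_J_J, F.symm x (F.J x)] at h
  linarith

theorem neg_le_pos (F : FundamentalSymmetry b) (x : E) : -b x x ≤ b (F.J x) x := by
  have h := F.nonneg (x + F.J x)
  simp only [map_add, LinearMap.add_apply, F.invol, F.apply_J_J, F.symm x (F.J x)] at h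
  linarith

end FundamentalSymmetry

/-- The set of points above the graph of the quadratic form `x ↦ b x x / 2`. -/
def quadEpigraph (b : LinearMap.BilinForm ℝ E) : Set (E × ℝ) :=
  {p | b p.1 p.1 / 2 ≤ p.2}

theorem continuous_bilin [FiniteDimensional ℝ E] {X : Type*} [TopologicalSpace X] {f g : X → E}
    (hf : Continuous f) (hg : Continuous g) : Continuous fun x => b (f x) (g x) := by
  have h : Continuous fun p : E × E => LinearMap.toContinuousBilinearMap b p.1 p.2 := by fun_prop
  exact h.comp (hf.prodMk hg)

theorem quad_segment (hb : ∀ x y, b x y = b y x) (x y : E) {s t : ℝ} (hst : s + t = 1) :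
    b (s • x + t • y) (s • x + t • y) = s * b x x + t * b y y - s * t * b (x - y) (x - y) := by
  obtain rfl : s = 1 - t := by linarith
  simp only [map_add, map_sub, map_smul, LinearMap.add_apply, LinearMap.sub_apply,
    LinearMap.smul_apply, smul_eq_mul, hb y x]
  ring

/-- If `C` is maximal among the convex sets above the graph of `b x x / 2`, then every point
`(x, r)` above that graph with `b x y ≤ r + s` for all `(y, s)` in `C` is in `C`: joining it to `C`
by segments stays above the graph. -/
theorem mem_of_maximal (hb : ∀ x y, b x y = b y x) {C : Set (E × ℝ)}
    (hC : Maximal (fun C => Convex ℝ C ∧ C ⊆ quadEpigraph b) C)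
    (hne : C.Nonempty) {x : E} {r : ℝ} (hr : b x x / 2 ≤ r) (h : ∀ p ∈ C, b x p.1 ≤ r + p.2) :
    (x, r) ∈ C := by
  have hsub : convexHull ℝ (insert (x, r) C) ⊆ quadEpigraph b := by
    rw [convexHull_insert hne, hC.prop.1.convexHull_eq]
    intro p hp
    simp only [mem_convexJoin, Set.mem_singleton_iff, exists_eq_left] at hp
    obtain ⟨⟨y, s⟩, hy, t, u, ht, hu, htu, rfl⟩ := hp
    have h1 := h _ hy
    have h2 : b y y / 2 ≤ s := hC.prop.2 hy
    simp only [quadEpigraph, Set.mem_ofPred_eq, Prod.smul_mk, Prod.mk_add_mk, smul_eq_mul]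
    rw [quad_segment hb x y htu]
    simp only [map_sub, LinearMap.sub_apply, hb y x] at *
    obtain rfl : u = 1 - t := by linarith
    have e2 : 0 ≤ t * (1 - t) * (r + s - b x y) := mul_nonneg (mul_nonneg ht hu) (by linarith)
    have e3 : 0 ≤ (1 - t) * (1 - t) * (s - b y y / 2) := mul_nonneg (mul_nonneg hu hu) (by linarith)
    have e4 : 0 ≤ t * t * (r - b x x / 2) := mul_nonneg (mul_nonneg ht ht) (by linarith)
    linarith
  have := hC.le_of_ge ⟨convex_convexHull ℝ _, hsub⟩
    ((Set.subset_insert _ _).trans (subset_convexHull ℝ _))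
  exact this (subset_convexHull ℝ _ (Set.mem_insert _ _))

theorem isClosed_quadEpigraph [FiniteDimensional ℝ E] : IsClosed (quadEpigraph b) :=
  isClosed_le ((continuous_bilin continuous_fst continuous_fst).div_const 2) continuous_snd

theorem isClosed_of_maximal [FiniteDimensional ℝ E] {C : Set (E × ℝ)}
    (hC : Maximal (fun C => Convex ℝ C ∧ C ⊆ quadEpigraph b) C) : IsClosed C :=
  closure_subset_iff_isClosed.1 <| hC.le_of_ge
    ⟨hC.prop.1.closure, closure_minimal hC.prop.2 isClosed_quadEpigraph⟩ subset_closure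

theorem exists_maximal_convex {A : Set (E × ℝ)} (hA : Convex ℝ A) (hAb : A ⊆ quadEpigraph b) :
    ∃ C, A ⊆ C ∧ Maximal (fun C => Convex ℝ C ∧ C ⊆ quadEpigraph b) C := by
  refine zorn_subset_nonempty {C : Set (E × ℝ) | Convex ℝ C ∧ C ⊆ quadEpigraph b} ?_ A ⟨hA, hAb⟩
  intro c hc hchain hcne
  exact ⟨⋃₀ c, ⟨hchain.directedOn.convex_sUnion fun s hs => (hc hs).1,
    Set.sUnion_subset fun s hs => (hc hs).2⟩, fun s hs => Set.subset_sUnion_of_mem hs⟩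

/-- A positive definite form dominates a multiple of the squared norm. -/
theorem FundamentalSymmetry.exists_norm_sq_le [FiniteDimensional ℝ E] (F : FundamentalSymmetry b) :
    ∃ c > 0, ∀ x, c * ‖x‖ ^ 2 ≤ b (F.J x) x := by
  have hcont : Continuous fun x => b (F.J x) x :=
    continuous_bilin (LinearMap.continuous_of_finiteDimensional F.J) continuous_id
  have : ProperSpace E := FiniteDimensional.proper ℝ E
  rcases (Metric.sphere (0 : E) 1).eq_empty_or_nonempty with h0 | h0
  · refine ⟨1, one_pos, fun x => ?_⟩
    have : x = 0 := by
      by_contra hx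
      have h1 : ‖x‖⁻¹ • x ∈ Metric.sphere (0 : E) 1 := by
        simp [norm_smul, inv_mul_cancel₀ (norm_ne_zero_iff.2 hx)]
      simp [h0] at h1
    simp [this]
  · obtain ⟨z, hz, hmin⟩ := (isCompact_sphere (0 : E) 1).exists_isMinOn h0 hcont.continuousOn
    have hz0 : z ≠ 0 := by
      rintro rfl
      simp at hz
    refine ⟨b (F.J z) z, F.pos z hz0, fun x => ?_⟩
    rcases eq_or_ne x 0 with rfl | hx
    · simp
    have hn : 0 < ‖x‖ := norm_pos_iff.2 hx
    have h1 : ‖x‖⁻¹ • x ∈ Metric.sphere (0 : E) 1 := by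
      simp [norm_smul, inv_mul_cancel₀ hn.ne']
    have h2 := hmin h1
    simp only [Set.mem_ofPred_eq, map_smul, LinearMap.smul_apply, smul_eq_mul] at h2
    calc b (F.J z) z * ‖x‖ ^ 2 ≤ (‖x‖⁻¹ * (‖x‖⁻¹ * b (F.J x) x)) * ‖x‖ ^ 2 := by gcongr
      _ = b (F.J x) x := by field_simp

/-- Minimization of the strongly convex function
`(y, s) ↦ s - b x y + b x x / 2 + b (J (y - x)) (y - x) / 2` over a closed convex set above the graph
of `b y y / 2`. The function is nonnegative there, and comparison with the midpoint shows that its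
sublevel sets are bounded. -/
theorem exists_isMinOn_of_convex [FiniteDimensional ℝ E] (F : FundamentalSymmetry b)
    {C : Set (E × ℝ)} (hconv : Convex ℝ C) (hcl : IsClosed C) (hne : C.Nonempty)
    (hCb : C ⊆ quadEpigraph b) (x : E) :
    ∃ p ∈ C, IsMinOn (fun p : E × ℝ =>
      p.2 - b x p.1 + b x x / 2 + b (F.J (p.1 - x)) (p.1 - x) / 2) C p := by
  set f : E × ℝ → ℝ := fun p => p.2 - b x p.1 + b x x / 2 + b (F.J (p.1 - x)) (p.1 - x) / 2 with hf
  have hJ := LinearMap.continuous_of_finiteDimensional F.J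
  have hfc : Continuous f := by
    have h1 : Continuous fun p : E × ℝ => b x p.1 := continuous_bilin continuous_const continuous_fst
    have h2 : Continuous fun p : E × ℝ => b (F.J (p.1 - x)) (p.1 - x) :=
      continuous_bilin (hJ.comp (continuous_fst.sub continuous_const))
        (continuous_fst.sub continuous_const)
    exact ((continuous_snd.sub h1).add continuous_const).add (h2.div_const 2)
  have hnonneg : ∀ p ∈ C, 0 ≤ f p := by
    intro p hp
    have h1 : b p.1 p.1 / 2 ≤ p.2 := hCb hp
    have h2 := F.neg_le_pos (p.1 - x)
    have h7 : b (p.1 - x) (p.1 - x) = b p.1 p.1 - 2 * b x p.1 + b x x := by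
      simp only [map_sub, LinearMap.sub_apply, F.symm p.1 x]; ring
    simp only [hf]
    linarith
  obtain ⟨c, hc, hcB⟩ := F.exists_norm_sq_le
  obtain ⟨p₀, hp₀⟩ := hne
  have hbound : ∀ p ∈ C, f p ≤ f p₀ → c * ‖p.1 - p₀.1‖ ^ 2 ≤ 8 * f p₀ := by
    intro p hp hle
    have hm := hnonneg _ (hconv hp hp₀ (by norm_num : (0 : ℝ) ≤ 1 / 2)
      (by norm_num : (0 : ℝ) ≤ 1 / 2) (by norm_num))
    have hmid : f ((1 / 2 : ℝ) • p + (1 / 2 : ℝ) • p₀)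
        = f p / 2 + f p₀ / 2 - b (F.J (p.1 - p₀.1)) (p.1 - p₀.1) / 8 := by
      have h1 : ((1 / 2 : ℝ) • p + (1 / 2 : ℝ) • p₀).1 - x
          = (1 / 2 : ℝ) • (p.1 - x) + (1 / 2 : ℝ) • (p₀.1 - x) := by
        simp only [Prod.fst_add, Prod.smul_fst]
        module
      have h2 : p.1 - p₀.1 = (p.1 - x) - (p₀.1 - x) := by abel
      simp only [hf, h1]
      rw [h2]
      have h3 : b x ((1 / 2 : ℝ) • p + (1 / 2 : ℝ) • p₀).1 = b x p.1 / 2 + b x p₀.1 / 2 := by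
        simp; ring
      rw [h3]
      generalize p.1 - x = u
      generalize p₀.1 - x = v
      simp only [map_add, map_sub, map_smul, LinearMap.add_apply, LinearMap.sub_apply,
        LinearMap.smul_apply, smul_eq_mul, Prod.snd_add, Prod.smul_snd, F.J_comm v u]
      ring
    rw [hmid] at hm
    have := hcB (p.1 - p₀.1)
    linarith
  have : ProperSpace E := FiniteDimensional.proper ℝ E
  set R : ℝ := 8 * f p₀ / c + 1 with hR
  have hR1 : 1 ≤ R := by
    have := hnonneg p₀ hp₀
    have : 0 ≤ 8 * f p₀ / c := by positivity
    linarith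
  have hb1 : ∀ p ∈ C, f p ≤ f p₀ → ‖p.1 - p₀.1‖ ≤ R := by
    intro p hp hle
    have h1 := hbound p hp hle
    have h2 : ‖p.1 - p₀.1‖ ^ 2 ≤ R := by
      have : ‖p.1 - p₀.1‖ ^ 2 ≤ 8 * f p₀ / c := by
        rw [le_div_iff₀ hc]; linarith
      linarith
    nlinarith [norm_nonneg (p.1 - p₀.1)]
  set g : E → ℝ := fun y => b x y - b x x / 2 - b (F.J (y - x)) (y - x) / 2 with hg
  have hgc : Continuous g := by
    have h1 : Continuous fun y : E => b x y := continuous_bilin continuous_const continuous_id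
    have h2 : Continuous fun y : E => b (F.J (y - x)) (y - x) :=
      continuous_bilin (hJ.comp (continuous_id.sub continuous_const))
        (continuous_id.sub continuous_const)
    exact (h1.sub continuous_const).sub (h2.div_const 2)
  obtain ⟨M, hM⟩ := ((isCompact_closedBall p₀.1 R).image hgc.abs).bddAbove
  have hcomp : IsCompact {p ∈ C | f p ≤ f p₀} := by
    refine Metric.isCompact_of_isClosed_isBounded (hcl.inter (isClosed_le hfc continuous_const)) ?_
    refine ((isCompact_closedBall p₀.1 R).prod
      (isCompact_Icc (a := -M) (b := f p₀ + M))).isBounded.subset ?_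
    rintro p ⟨hp, hle⟩
    have h1 := hb1 p hp hle
    have h2 : p.1 ∈ Metric.closedBall p₀.1 R := by rwa [mem_closedBall_iff_norm]
    have h3 : |g p.1| ≤ M := hM ⟨_, h2, rfl⟩
    have h4 : p.2 = f p + g p.1 := by simp only [hf, hg]; ring
    have h5 := hnonneg p hp
    have h6 := abs_le.1 h3
    exact ⟨h2, by rw [Set.mem_Icc, h4]; constructor <;> linarith⟩
  obtain ⟨p, hp, hmin⟩ := hcomp.exists_isMinOn ⟨p₀, hp₀, le_rfl⟩ hfc.continuousOn
  refine ⟨p, hp.1, fun z hz => ?_⟩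
  rcases le_total (f z) (f p₀) with h | h
  · exact hmin ⟨hz, h⟩
  · exact le_trans hp.2 h

/-- The points where a maximal convex set `C` touches the graph of `b x x / 2` meet each translate
of the negative eigenspace of the fundamental symmetry `J`. The point over `x` comes from the
minimizer `(y, s)` of `exists_isMinOn_of_convex`: with `w = y - x`, the first order condition says
that `(x - J w, r)` satisfies the inequality of `mem_of_maximal` for `r = b (x - J w) y - s`, which
by maximality forces `b (w + J w) (w + J w) ≤ 0`, and so `J w = -w`. -/
theorem exists_touching_of_maximal [FiniteDimensional ℝ E] (F : FundamentalSymmetry b)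
    {C : Set (E × ℝ)} (hC : Maximal (fun C => Convex ℝ C ∧ C ⊆ quadEpigraph b) C)
    (hne : C.Nonempty) (x : E) :
    ∃ z, (z, b z z / 2) ∈ C ∧ F.J (z - x) = -(z - x) := by
  obtain ⟨⟨y, s⟩, hy, hmin⟩ :=
    exists_isMinOn_of_convex F hC.prop.1 (isClosed_of_maximal hC) hne hC.prop.2 x
  -- the first order condition at the minimizer
  have hfoc : ∀ p ∈ C, s - b x y + b (F.J (y - x)) y ≤ p.2 - b x p.1 + b (F.J (y - x)) p.1 := by
    intro p hp
    by_contra! hlt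
    set a := (p.2 - b x p.1 + b (F.J (y - x)) p.1) - (s - b x y + b (F.J (y - x)) y) with ha
    set e := b (F.J (p.1 - y)) (p.1 - y) with he
    have he0 : 0 ≤ e := F.nonneg _
    have ha0 : a < 0 := by linarith
    have key : ∀ t : ℝ, 0 ≤ t → t ≤ 1 → 0 ≤ t * a + t ^ 2 * e / 2 := by
      intro t ht0 ht1
      have h1 := hmin (hC.prop.1 hy hp (sub_nonneg.2 ht1) ht0 (by ring))
      simp only [Set.mem_ofPred_eq, Prod.fst_add, Prod.smul_fst, Prod.snd_add, Prod.smul_snd,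
        smul_eq_mul] at h1
      have h2 : (1 - t) • y + t • p.1 - x = (y - x) + t • (p.1 - y) := by module
      have h3 : b x ((1 - t) • y + t • p.1) = (1 - t) * b x y + t * b x p.1 := by simp
      rw [h2, h3] at h1
      have h4 : b (F.J ((y - x) + t • (p.1 - y))) ((y - x) + t • (p.1 - y))
          = b (F.J (y - x)) (y - x) + 2 * t * b (F.J (y - x)) (p.1 - y) + t ^ 2 * e := by
        rw [he]
        generalize y - x = u
        generalize p.1 - y = v
        simp only [map_add, map_smul, LinearMap.add_apply,
          LinearMap.smul_apply, smul_eq_mul, F.J_comm v u]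
        ring
      rw [h4, map_sub (b (F.J (y - x))) p.1 y] at h1
      rw [ha]
      linarith
    have hpos : 0 < e - 2 * a := by linarith
    have h1 := key (-a / (e - 2 * a)) (div_nonneg (by linarith) hpos.le)
      ((div_le_one hpos).2 (by linarith))
    have h2 : -a / (e - 2 * a) * a + (-a / (e - 2 * a)) ^ 2 * e / 2
        = -(a ^ 2 * (e - 4 * a)) / (2 * (e - 2 * a) ^ 2) := by
      field_simp; ring
    rw [h2] at h1
    have h3 : -(a ^ 2 * (e - 4 * a)) / (2 * (e - 2 * a) ^ 2) < 0 :=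
      div_neg_of_neg_of_pos (by
        have : 0 < a ^ 2 * (e - 4 * a) := mul_pos (sq_pos_of_neg ha0) (by linarith)
        linarith) (by positivity)
    linarith
  set w := y - x with hw
  set x₁ := x - F.J w with hx₁
  set r := b x₁ y - s with hr
  have hx₁b : ∀ u, b x₁ u = b x u - b (F.J w) u := fun u => by simp [hx₁]
  have hle : ∀ p ∈ C, b x₁ p.1 ≤ r + p.2 := by
    intro p hp
    have := hfoc p hp
    rw [hr, hx₁b, hx₁b]
    linarith
  have hmem : (x₁, max r (b x₁ x₁ / 2)) ∈ C :=
    mem_of_maximal F.symm hC hne (le_max_right _ _) fun p hp =>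
      (hle p hp).trans (by gcongr; exact le_max_left _ _)
  have h1 := hle _ hmem
  have h2 : b x₁ x₁ / 2 ≤ r := by
    rcases le_total r (b x₁ x₁ / 2) with h | h
    · simp only [max_eq_right h] at h1
      linarith
    · exact h
  have h3 : b y y / 2 ≤ s := hC.prop.2 hy
  have h4 : y - x₁ = w + F.J w := by rw [hx₁, hw]; abel
  have h5 : b (w + F.J w) (w + F.J w) ≤ 0 := by
    rw [← h4]
    simp only [map_sub, LinearMap.sub_apply, F.symm y x₁]
    linarith
  have h6 := F.J_eq_neg h5
  refine ⟨y, ?_, h6⟩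
  have h7 : x₁ = y := by
    have : y - x₁ = 0 := by rw [h4, h6]; simp
    exact (sub_eq_zero.1 this).symm
  rw [h7] at h2 hr
  have h8 : s = b y y / 2 := by linarith
  rwa [← h8]

/-- A nonempty convex set above the graph of `b x x / 2` is, in the sense of the Fitzpatrick
function, above a `b`-monotone set that meets each translate of the negative eigenspace. -/
theorem exists_monotone_of_convex [FiniteDimensional ℝ E] (F : FundamentalSymmetry b)
    {A : Set (E × ℝ)} (hA : Convex ℝ A) (hAb : A ⊆ quadEpigraph b) (hne : A.Nonempty) :
    ∃ G : Set E, (∀ x ∈ G, ∀ y ∈ G, 0 ≤ b (x - y) (x - y)) ∧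
      (∀ p ∈ A, ∀ x ∈ G, b x p.1 - b x x / 2 ≤ p.2) ∧
      (∀ x, ∃ z ∈ G, F.J (z - x) = -(z - x)) ∧ ∀ x, (x, b x x / 2) ∈ A → x ∈ G := by
  obtain ⟨C, hAC, hC⟩ := exists_maximal_convex hA hAb
  refine ⟨{x | (x, b x x / 2) ∈ C}, fun x hx y hy => ?_, fun p hp x hx => ?_,
    fun x => exists_touching_of_maximal F hC (hne.mono hAC) x, fun x hx => hAC hx⟩
  · have h := hC.prop.2 (hC.prop.1 hx hy (by norm_num : (0 : ℝ) ≤ 1 / 2)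
      (by norm_num : (0 : ℝ) ≤ 1 / 2) (by norm_num))
    simp only [quadEpigraph, Set.mem_ofPred_eq, Prod.smul_mk, Prod.mk_add_mk, smul_eq_mul] at h
    rw [quad_segment F.symm x y (by norm_num)] at h
    linarith
  · -- the affine function `y ↦ b x y - b x x / 2` is tangent to the quadratic form at `x`
    have key : ∀ t : ℝ, 0 ≤ t → t ≤ 1 →
        0 ≤ t * (p.2 - b p.1 p.1 / 2) + (1 - t) * t * (b (x - p.1) (x - p.1) / 2) := by
      intro t ht0 ht1
      have h := hC.prop.2 (hC.prop.1 hx (hAC hp) (sub_nonneg.2 ht1) ht0 (by ring))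
      simp only [quadEpigraph, Set.mem_ofPred_eq, Prod.fst_add, Prod.smul_fst, Prod.snd_add,
        Prod.smul_snd, smul_eq_mul] at h
      rw [quad_segment F.symm x p.1 (by ring)] at h
      linarith
    have h1 : 0 ≤ p.2 - b p.1 p.1 / 2 + b (x - p.1) (x - p.1) / 2 := by
      by_contra! hlt
      set a := p.2 - b p.1 p.1 / 2 with ha
      set e := b (x - p.1) (x - p.1) / 2 with he
      have ha0 : 0 ≤ a := by
        have : b p.1 p.1 / 2 ≤ p.2 := hAb hp
        linarith
      have he0 : e < 0 := by linarith
      -- at this `t` the second factor of `t * (a + (1 - t) * e)` is `(a + e) / 2`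
      have h2 := key ((a + e) / (2 * e)) (div_nonneg_of_nonpos (by linarith) (by linarith))
        ((div_le_one_of_neg (by linarith)).2 (by linarith))
      have h3 : (a + e) / (2 * e) * a + (1 - (a + e) / (2 * e)) * ((a + e) / (2 * e)) * e
          = (a + e) / (2 * e) * ((a + e) / 2) := by
        have := he0.ne
        field_simp; ring
      rw [h3] at h2
      have h4 : (a + e) / (2 * e) * ((a + e) / 2) < 0 :=
        mul_neg_of_pos_of_neg (div_pos_of_neg_of_neg hlt (by linarith)) (by linarith)
      linarith
    simp only [map_sub, LinearMap.sub_apply, F.symm p.1 x] at h1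
    linarith

end Convex

/-! ### Maximal monotone sets -/

section

section Monotone

variable {E : Type*} [NormedAddCommGroup E] [NormedSpace ℝ E]
  {b : LinearMap.BilinForm ℝ E}

/-- The convex hull of the points of the graph of `b x x / 2` over a `b`-monotone set stays above
that graph. Indeed, the tangent at `x ∈ G` is below the points over `G`, hence below their convex
hull; so a point `(y, r)` of the hull gives an affine function `b x y - r ≤ b x x / 2` of `x ∈ G`,
which extends to the hull and can be evaluated at `(y, r)` itself. -/
theorem convexHull_subset_quadEpigraph (hb : ∀ x y, b x y = b y x) {G : Set E}
    (hG : ∀ x ∈ G, ∀ y ∈ G, 0 ≤ b (x - y) (x - y)) :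
    convexHull ℝ ((fun x => (x, b x x / 2)) '' G) ⊆ quadEpigraph b := by
  have half : ∀ (u : E) (c : ℝ), Convex ℝ {p : E × ℝ | b u p.1 - c ≤ p.2} := by
    intro u c p hp z hz s t hs ht hst
    simp only [Set.mem_ofPred_eq, Prod.fst_add, Prod.smul_fst, Prod.snd_add, Prod.smul_snd,
      smul_eq_mul, map_add, map_smul] at *
    obtain rfl : s = 1 - t := by linarith
    nlinarith [mul_le_mul_of_nonneg_left hp hs, mul_le_mul_of_nonneg_left hz ht]
  have h1 : ∀ x ∈ G, convexHull ℝ ((fun x => (x, b x x / 2)) '' G)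
      ⊆ {p : E × ℝ | b x p.1 - b x x / 2 ≤ p.2} := by
    intro x hx
    refine convexHull_min ?_ (half _ _)
    rintro _ ⟨y, hy, rfl⟩
    have := hG x hx y hy
    simp only [map_sub, LinearMap.sub_apply, hb y x] at this
    simp only [Set.mem_ofPred_eq]
    linarith
  intro p hp
  have h2 : convexHull ℝ ((fun x => (x, b x x / 2)) '' G)
      ⊆ {z : E × ℝ | b p.1 z.1 - p.2 ≤ z.2} := by
    refine convexHull_min ?_ (half _ _)
    rintro _ ⟨y, hy, rfl⟩
    have : b y p.1 - b y y / 2 ≤ p.2 := h1 y hy hp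
    simp only [Set.mem_ofPred_eq]
    rw [hb p.1 y]
    linarith
  have h3 : b p.1 p.1 - p.2 ≤ p.2 := h2 hp
  change b p.1 p.1 / 2 ≤ p.2
  linarith

/-- Two points of a `b`-monotone set, lying over `x` and `x'` along the negative eigenspace, are not
further apart than `x` and `x'` up to a constant factor. -/
theorem FundamentalSymmetry.dist_le (F : FundamentalSymmetry b) {x x' z z' : E}
    (h : 0 ≤ b (z - z') (z - z')) (hz : F.J (z - x) = -(z - x))
    (hz' : F.J (z' - x') = -(z' - x')) :
    b (F.J (z - z')) (z - z') ≤ 2 * b (F.J (x - x')) (x - x') := by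
  obtain ⟨v, hv⟩ : ∃ v, v = (z - x) - (z' - x') := ⟨_, rfl⟩
  have hJv : F.J v = -v := by rw [hv, map_sub, hz, hz']; abel
  have hzz : z - z' = (x - x') + v := by rw [hv]; abel
  have h1 := F.le_pos (x - x')
  rw [hzz] at h ⊢
  generalize x - x' = u at *
  have h2 := F.J_comm u v
  have h3 := F.symm v u
  simp only [map_add, LinearMap.add_apply, hJv, map_neg, LinearMap.neg_apply] at h h2 ⊢
  linarith

end Monotone

variable {d : ℕ} {S : Matrix (Fin d) (Fin d) ℝ} {G : Set (Space d)}

theorem isSMonotone_iff :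
    IsSMonotone S G ↔ ∀ x ∈ G, ∀ y ∈ G, 0 ≤ bilin S (x - y) (x - y) := Iff.rfl

/-- A monotone set that meets every translate of the negative eigenspace is maximal. -/
theorem mem_maximalMonotoneSets_of_touching (F : FundamentalSymmetry (bilin S))
    (hG : IsSMonotone S G) (h : ∀ x, ∃ z ∈ G, F.J (z - x) = -(z - x)) :
    G ∈ maximalMonotoneSets S := by
  refine ⟨hG, fun H hH hGH x hx => ?_⟩
  obtain ⟨z, hz, hzx⟩ := h x
  have h0 : z - x = 0 := F.eq_zero_of_J_eq_neg hzx (hH z (hGH hz) x hx)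
  rwa [← sub_eq_zero.1 h0]

theorem nonempty_of_mem_maximalMonotoneSets (hG : G ∈ maximalMonotoneSets S) : G.Nonempty := by
  by_contra h
  rw [Set.not_nonempty_iff_eq_empty] at h
  subst h
  have h0 : IsSMonotone S ({0} : Set (Space d)) := by
    rintro x rfl y rfl
    simp [form]
  exact hG.2 h0 (Set.empty_subset _) (Set.mem_singleton (0 : Space d))

/-- Minty's parametrization: moving along the negative eigenspace of a fundamental symmetry is a
Lipschitz map of the whole space into a maximal monotone set. -/
theorem exists_lipschitz_selection (F : FundamentalSymmetry (bilin S))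
    (hG : G ∈ maximalMonotoneSets S) :
    ∃ f : Space d → Space d, (∃ K, LipschitzWith K f) ∧
      ∀ x, f x ∈ G ∧ F.J (f x - x) = -(f x - x) := by
  have htouch : ∀ x, ∃ z ∈ G, F.J (z - x) = -(z - x) := by
    obtain ⟨H, hH, -, hH', hGH⟩ := exists_monotone_of_convex F (convex_convexHull ℝ _)
      (convexHull_subset_quadEpigraph F.symm (isSMonotone_iff.1 hG.1))
      ((nonempty_of_mem_maximalMonotoneSets hG).image _).convexHull
    have hsub : G ⊆ H := fun x hx =>
      hGH x (subset_convexHull ℝ _ (Set.mem_image_of_mem _ hx))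
    have : H ⊆ G := hG.2 hH hsub
    intro x
    obtain ⟨z, hz, h⟩ := hH' x
    exact ⟨z, this hz, h⟩
  choose f hf hfJ using htouch
  refine ⟨f, ?_, fun x => ⟨hf x, hfJ x⟩⟩
  obtain ⟨c, hc, hcB⟩ := F.exists_norm_sq_le
  obtain ⟨M, hM0, hM⟩ : ∃ M, 0 ≤ M ∧ ∀ x, bilin S (F.J x) x ≤ M * ‖x‖ ^ 2 := by
    let T := LinearMap.toContinuousBilinearMap (bilin S)
    let J := F.J.toContinuousLinearMap
    refine ⟨‖T‖ * ‖J‖, by positivity, fun x => ?_⟩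
    calc bilin S (F.J x) x ≤ ‖T (J x) x‖ := le_abs_self _
      _ ≤ ‖T‖ * ‖J x‖ * ‖x‖ := T.le_opNorm₂ _ _
      _ ≤ ‖T‖ * (‖J‖ * ‖x‖) * ‖x‖ := by gcongr; exact J.le_opNorm x
      _ = ‖T‖ * ‖J‖ * ‖x‖ ^ 2 := by ring
  refine ⟨Real.toNNReal (Real.sqrt (2 * M / c)), LipschitzWith.of_dist_le_mul fun x y => ?_⟩
  rw [Real.coe_toNNReal _ (Real.sqrt_nonneg _), dist_eq_norm, dist_eq_norm]
  have h1 := F.dist_le (hG.1 _ (hf x) _ (hf y)) (hfJ x) (hfJ y)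
  have h2 := hcB (f x - f y)
  have h3 := hM (x - y)
  have h4 : ‖f x - f y‖ ^ 2 ≤ 2 * M / c * ‖x - y‖ ^ 2 := by
    rw [div_mul_eq_mul_div, le_div_iff₀ hc]
    linarith
  calc ‖f x - f y‖ = Real.sqrt (‖f x - f y‖ ^ 2) := (Real.sqrt_sq (norm_nonneg _)).symm
    _ ≤ Real.sqrt (2 * M / c * ‖x - y‖ ^ 2) := Real.sqrt_le_sqrt h4
    _ = Real.sqrt (2 * M / c) * ‖x - y‖ := by
      rw [Real.sqrt_mul (by positivity), Real.sqrt_sq (norm_nonneg _)]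

theorem le_fitzpatrick {x : Space d} (hx : x ∈ G) (y : Space d) :
    ((form S x y - (1 / 2) * form S x x : ℝ) : EReal) ≤ fitzpatrick S G y :=
  le_iSup₂ (f := fun x (_ : x ∈ G) => ((form S x y - (1 / 2) * form S x x : ℝ) : EReal)) x hx

theorem continuous_form {X : Type*} [TopologicalSpace X] {f g : X → Space d}
    (hf : Continuous f) (hg : Continuous g) : Continuous fun x => form S (f x) (g x) :=
  continuous_bilin (b := bilin S) hf hg

theorem measurable_fitzpatrick : Measurable (fitzpatrick S G) := by
  refine LowerSemicontinuous.measurable ?_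
  refine lowerSemicontinuous_biSup fun x _ => Continuous.lowerSemicontinuous ?_
  exact continuous_coe_real_ereal.comp
    ((continuous_form continuous_const continuous_id).sub continuous_const)

theorem form_sub_self (hS : S.IsHermitian) (x y : Space d) :
    form S (x - y) (x - y) = form S y y - 2 * (form S x y - (1 / 2) * form S x x) := by
  simp only [← bilin_apply, map_sub, LinearMap.sub_apply, bilin_symm hS y x]
  ring

/-- A point of `G` at which the supremum defining the Fitzpatrick function is attained is a
projection. -/
theorem mem_proj_of_fitzpatrick_le (hS : S.IsHermitian) {x y : Space d} (hx : x ∈ G)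
    (h : fitzpatrick S G y ≤ ((form S x y - (1 / 2) * form S x x : ℝ) : EReal)) :
    x ∈ proj S G y := by
  refine ⟨hx, fun z hz => ?_⟩
  have := EReal.coe_le_coe_iff.1 ((le_fitzpatrick hz y).trans h)
  rw [form_sub_self hS, form_sub_self hS]
  linarith

theorem isClosed_of_mem_maximalMonotoneSets (hG : G ∈ maximalMonotoneSets S) : IsClosed G := by
  have hcl : IsClosed {p : Space d × Space d | 0 ≤ form S (p.1 - p.2) (p.1 - p.2)} :=
    isClosed_le continuous_const (continuous_form (continuous_fst.sub continuous_snd)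
      (continuous_fst.sub continuous_snd))
  have h1 : closure (G ×ˢ G) ⊆ {p : Space d × Space d | 0 ≤ form S (p.1 - p.2) (p.1 - p.2)} := by
    refine closure_minimal ?_ hcl
    rintro ⟨x, y⟩ ⟨hx, hy⟩
    simp only [Set.mem_ofPred_eq]
    exact hG.1 x hx y hy
  have hm : IsSMonotone S (closure G) := by
    intro x hx y hy
    rw [closure_prod_eq] at h1
    have h2 := h1 (Set.mk_mem_prod hx hy)
    simp only [Set.mem_ofPred_eq] at h2
    exact h2
  exact closure_subset_iff_isClosed.1 (Maximal.le_of_ge hG hm subset_closure)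

/-! ### Measurability of the projection -/

theorem isClosed_graph_proj (hG : G ∈ maximalMonotoneSets S) :
    IsClosed {p : Space d × Space d | p.1 ∈ proj S G p.2} := by
  have : {p : Space d × Space d | p.1 ∈ proj S G p.2} = {p | p.1 ∈ G} ∩ ⋂ z ∈ G,
      {p : Space d × Space d |
        form S (p.1 - p.2) (p.1 - p.2) ≤ form S (z - p.2) (z - p.2)} := by
    ext p
    simp [proj]
  rw [this]
  refine ((isClosed_of_mem_maximalMonotoneSets hG).preimage continuous_fst).inter
    (isClosed_biInter fun z _ => isClosed_le ?_ ?_)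
  · exact continuous_form (continuous_fst.sub continuous_snd) (continuous_fst.sub continuous_snd)
  · exact continuous_form (continuous_const.sub continuous_snd)
      (continuous_const.sub continuous_snd)

/-- The set of points with a projection in a given closed set is a countable union of closed
sets. -/
theorem measurableSet_proj_inter (hG : G ∈ maximalMonotoneSets S) {C : Set (Space d)}
    (hC : IsClosed C) : MeasurableSet {y | (proj S G y ∩ C).Nonempty} := by
  have : {y | (proj S G y ∩ C).Nonempty} = ⋃ n : ℕ, Prod.snd ''
      ({p : Space d × Space d | p.1 ∈ proj S G p.2} ∩ ((C ∩ Metric.closedBall 0 n) ×ˢ Set.univ)) := by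
    ext y
    simp only [Set.mem_ofPred_eq, Set.mem_iUnion, Set.mem_image, Prod.exists, exists_eq_right]
    constructor
    · rintro ⟨x, hx, hxC⟩
      obtain ⟨n, hn⟩ := exists_nat_ge ‖x‖
      exact ⟨n, x, hx, ⟨hxC, by simpa using hn⟩, Set.mem_univ _⟩
    · rintro ⟨n, x, hx, ⟨hxC, -⟩, -⟩
      exact ⟨x, hx, hxC⟩
  rw [this]
  refine MeasurableSet.iUnion fun n => IsClosed.measurableSet ?_
  have hK : IsCompact (C ∩ Metric.closedBall (0 : Space d) n) :=
    (isCompact_closedBall 0 _).inter_left hC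
  have : CompactSpace (C ∩ Metric.closedBall (0 : Space d) n : Set (Space d)) :=
    isCompact_iff_compactSpace.1 hK
  -- the second projection is closed once the first factor is restricted to a compact set
  have hcl : IsClosed {p : (C ∩ Metric.closedBall (0 : Space d) n : Set (Space d)) × Space d |
      (p.1 : Space d) ∈ proj S G p.2} :=
    (isClosed_graph_proj hG).preimage
      ((continuous_subtype_val.comp continuous_fst).prodMk continuous_snd)
  convert isClosedMap_snd_of_compactSpace _ hcl using 1
  ext y
  simp only [Set.mem_image, Prod.exists, exists_eq_right, Subtype.exists, Set.mem_ofPred_eq,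
    Set.mem_inter_iff, Set.mem_prod, Set.mem_univ, and_true, exists_prop]
  exact exists_congr fun a => and_comm

theorem measurableSet_proj_nonempty (hG : G ∈ maximalMonotoneSets S) :
    MeasurableSet {y | (proj S G y).Nonempty} := by
  simpa using measurableSet_proj_inter hG isClosed_univ

theorem measurableSet_proj_eq_singleton (hG : G ∈ maximalMonotoneSets S) :
    MeasurableSet {y | ∃ x, proj S G y = {x}} := by
  -- two different projections are separated by a closed ball and the complement of a concentric
  -- larger ball, with rational radii and the centre in a countable dense set
  obtain ⟨D, hDc, hDd⟩ := TopologicalSpace.exists_countable_dense (Space d)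
  have htwo : MeasurableSet {y | ∃ x ∈ proj S G y, ∃ z ∈ proj S G y, x ≠ z} := by
    have : {y | ∃ x ∈ proj S G y, ∃ z ∈ proj S G y, x ≠ z} = ⋃ a ∈ D, ⋃ r : ℚ, ⋃ s : ℚ,
        ⋃ _ : (r : ℝ) < s, ({y | (proj S G y ∩ Metric.closedBall a r).Nonempty} ∩
          {y | (proj S G y ∩ (Metric.ball a s)ᶜ).Nonempty}) := by
      ext y
      simp only [Set.mem_ofPred_eq, Set.mem_iUnion, exists_prop, Set.mem_inter_iff]
      constructor
      · rintro ⟨x, hx, z, hz, hxz⟩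
        obtain ⟨a, ha, hax⟩ := hDd.exists_dist_lt x (half_pos (dist_pos.2 hxz))
        have h1 : dist x a < dist z a := by
          have := dist_triangle x a z
          rw [dist_comm a z] at this
          linarith
        obtain ⟨s, hs1, hs2⟩ := exists_rat_btwn h1
        obtain ⟨r, hr1, hr2⟩ := exists_rat_btwn hs1
        exact ⟨a, ha, r, s, hr2, ⟨x, hx, by simpa using hr1.le⟩, ⟨z, hz, by simpa using hs2.le⟩⟩
      · rintro ⟨a, -, r, s, hrs, ⟨x, hx, hxa⟩, ⟨z, hz, hza⟩⟩
        refine ⟨x, hx, z, hz, ?_⟩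
        rintro rfl
        simp only [Metric.mem_closedBall, Set.mem_compl_iff, Metric.mem_ball, not_lt] at hxa hza
        linarith
    rw [this]
    refine MeasurableSet.biUnion hDc fun a _ => MeasurableSet.iUnion fun r =>
      MeasurableSet.iUnion fun s => MeasurableSet.iUnion fun _ => ?_
    exact (measurableSet_proj_inter hG Metric.isClosed_closedBall).inter
      (measurableSet_proj_inter hG Metric.isOpen_ball.isClosed_compl)
  convert (measurableSet_proj_nonempty hG).diff htwo using 1
  ext y
  simp only [Set.mem_ofPred_eq, Set.mem_sdiff, Set.exists_eq_singleton_iff_nonempty_subsingleton]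
  refine and_congr_right fun _ => ?_
  push Not
  rfl

theorem measurableSet_singularSet (hG : G ∈ maximalMonotoneSets S) :
    MeasurableSet (singularSet S G) :=
  (measurableSet_proj_nonempty hG).inter (measurableSet_proj_eq_singleton hG).compl

theorem proj_eq_singleton_projFun {y : Space d} (h : ∃ x, proj S G y = {x}) :
    proj S G y = {projFun S G y} := by
  rw [projFun, dif_pos h]
  exact h.choose_spec

theorem measurable_projFun (hG : G ∈ maximalMonotoneSets S) : Measurable (projFun S G) := by
  have hsing := measurableSet_proj_eq_singleton hG
  refine measurable_of_isClosed fun C hC => ?_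
  have : projFun S G ⁻¹' C = ({y | ∃ x, proj S G y = {x}} ∩ {y | (proj S G y ∩ C).Nonempty}) ∪
      ({y | ∃ x, proj S G y = {x}}ᶜ ∩ {_y | (0 : Space d) ∈ C}) := by
    ext y
    by_cases h : ∃ x, proj S G y = {x}
    · have := proj_eq_singleton_projFun h
      simp only [Set.mem_preimage, Set.mem_union, Set.mem_inter_iff, Set.mem_ofPred_eq, h,
        Set.mem_compl_iff, not_true, false_and, or_false, true_and]
      rw [this]
      simp
    · have : projFun S G y = 0 := dif_neg h
      simp [this, h]
  rw [this]
  exact (hsing.inter (measurableSet_proj_inter hG hC)).union (hsing.compl.inter (by simp))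

end

/-! ### Extended expectations -/

section


section ExtExpectation

variable {α : Type*} [MeasurableSpace α] {μ : Measure α}

theorem extExpectation_mono {f g : α → EReal} (h : f ≤ᵐ[μ] g) :
    extExpectation μ f ≤ extExpectation μ g := by
  refine EReal.sub_le_sub (EReal.coe_ennreal_le_coe_ennreal_iff.2 (lintegral_mono_ae ?_))
    (EReal.coe_ennreal_le_coe_ennreal_iff.2 (lintegral_mono_ae ?_))
  · filter_upwards [h] with a ha using EReal.toENNReal_le_toENNReal ha
  · filter_upwards [h] with a ha using EReal.toENNReal_le_toENNReal (EReal.neg_le_neg_iff.2 ha)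

theorem extExpectation_coe {g : α → ℝ} (hg : Integrable g μ) :
    extExpectation μ (fun a => (g a : EReal)) = ((∫ a, g a ∂μ : ℝ) : EReal) := by
  have h1 : ∫⁻ a, ENNReal.ofReal (g a) ∂μ ≠ ⊤ := hg.lintegral_lt_top.ne
  have h2 : ∫⁻ a, ENNReal.ofReal (-g a) ∂μ ≠ ⊤ := hg.neg.lintegral_lt_top.ne
  have h3 : ∀ A : ENNReal, A ≠ ⊤ → ((A.toReal : ℝ) : EReal) = (A : EReal) := by
    intro A hA
    lift A to NNReal using hA
    rfl
  rw [integral_eq_lintegral_pos_part_sub_lintegral_neg_part hg, EReal.coe_sub, h3 _ h1, h3 _ h2]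
  simp only [extExpectation, EReal.real_coe_toENNReal, ← EReal.coe_neg]

theorem extExpectation_map {β : Type*} [MeasurableSpace β] {T : α → β} (hT : Measurable T)
    {f : β → EReal} (hf : Measurable f) :
    extExpectation (μ.map T) f = extExpectation μ fun a => f (T a) := by
  rw [extExpectation, extExpectation, lintegral_map (by fun_prop) hT, lintegral_map _ hT]
  exact (measurable_ereal_toENNReal).comp hf.neg

/-- A function above an integrable one whose extended expectation is not larger agrees with it
almost everywhere. -/
theorem ae_eq_of_extExpectation_le {f : α → EReal} (hf : Measurable f) {g : α → ℝ}
    (hg : Integrable g μ) (hgf : ∀ᵐ a ∂μ, (g a : EReal) ≤ f a)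
    (h : extExpectation μ f ≤ ((∫ a, g a ∂μ : ℝ) : EReal)) : ∀ᵐ a ∂μ, f a = (g a : EReal) := by
  rw [← extExpectation_coe hg] at h
  have hpos : (fun a => ENNReal.ofReal (g a)) ≤ᵐ[μ] fun a => (f a).toENNReal := by
    filter_upwards [hgf] with a ha using EReal.toENNReal_le_toENNReal ha
  have hneg : (fun a => (-f a).toENNReal) ≤ᵐ[μ] fun a => ENNReal.ofReal (-g a) := by
    filter_upwards [hgf] with a ha
    have := EReal.toENNReal_le_toENNReal (EReal.neg_le_neg_iff.2 ha)
    rwa [← EReal.coe_neg] at this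
  have h1 : ∫⁻ a, ENNReal.ofReal (g a) ∂μ ≠ ⊤ := hg.lintegral_lt_top.ne
  have h2 : ∫⁻ a, ENNReal.ofReal (-g a) ∂μ ≠ ⊤ := hg.neg.lintegral_lt_top.ne
  have h3 := lintegral_mono_ae hpos
  have h4 := lintegral_mono_ae hneg
  simp only [extExpectation, EReal.real_coe_toENNReal, ← EReal.coe_neg] at h
  have h5 : ∫⁻ a, (f a).toENNReal ∂μ ≤ ∫⁻ a, ENNReal.ofReal (g a) ∂μ ∧
      ∫⁻ a, ENNReal.ofReal (-g a) ∂μ ≤ ∫⁻ a, (-f a).toENNReal ∂μ := by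
    have h6 : ∫⁻ a, (-f a).toENNReal ∂μ ≠ ⊤ := ne_top_of_le_ne_top h2 h4
    generalize ∫⁻ a, ENNReal.ofReal (g a) ∂μ = A at *
    generalize ∫⁻ a, ENNReal.ofReal (-g a) ∂μ = B at *
    generalize ∫⁻ a, (f a).toENNReal ∂μ = C at *
    generalize ∫⁻ a, (-f a).toENNReal ∂μ = D at *
    lift A to NNReal using h1
    lift B to NNReal using h2
    lift D to NNReal using h6
    induction C with
    | top =>
      exfalso
      have : ((D : ENNReal) : EReal) = ((D : ℝ) : EReal) := rfl
      rw [this, EReal.coe_ennreal_top, EReal.top_sub_coe] at h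
      have : ((A : ENNReal) : EReal) - ((B : ENNReal) : EReal) = (((A : ℝ) - (B : ℝ) : ℝ) : EReal) :=
        rfl
      rw [this] at h
      exact absurd h (not_le.2 (EReal.coe_lt_top _))
    | coe C =>
      have h7 : (((C : ℝ) - (D : ℝ) : ℝ) : EReal) ≤ (((A : ℝ) - (B : ℝ) : ℝ) : EReal) := h
      rw [EReal.coe_le_coe_iff] at h7
      have h8 : (A : ℝ) ≤ C := by exact_mod_cast h3
      have h9 : (D : ℝ) ≤ B := by exact_mod_cast h4
      constructor
      · have : (C : ℝ) ≤ A := by linarith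
        exact_mod_cast this
      · have : (B : ℝ) ≤ D := by linarith
        exact_mod_cast this
  have e1 := ae_eq_of_ae_le_of_lintegral_le hpos h1 (by fun_prop) h5.1
  have e2 := ae_eq_of_ae_le_of_lintegral_le hneg (ne_top_of_le_ne_top h2 h4)
    hg.neg.aemeasurable.ennreal_ofReal h5.2
  filter_upwards [e1, e2, hgf] with a h1 h2 h3
  refine le_antisymm ?_ h3
  induction hfa : f a with
  | bot => exact bot_le
  | top => simp [hfa] at h1
  | coe r =>
    rw [hfa, EReal.real_coe_toENNReal] at h1
    rw [hfa, ← EReal.coe_neg, EReal.real_coe_toENNReal] at h2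
    rw [EReal.coe_le_coe_iff]
    by_contra! hlt
    rcases le_or_gt r 0 with hr | hr
    · have h4 := (ENNReal.ofReal_eq_ofReal_iff (by linarith) (by linarith)).1 h2
      linarith
    · rw [eq_comm, ENNReal.ofReal_eq_ofReal_iff hr.le] at h1
      · linarith
      · by_contra! hg0
        rw [ENNReal.ofReal_of_nonpos hg0.le, ENNReal.ofReal_eq_zero] at h1
        linarith

end ExtExpectation

/-! ### Martingale plans -/

variable {d : ℕ} {S : Matrix (Fin d) (Fin d) ℝ} {G : Set (Space d)}

theorem integrable_form {α : Type*} [MeasurableSpace α] {μ : Measure α} {f g : α → Space d}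
    (hf : MemLp f 2 μ) (hg : MemLp g 2 μ) : Integrable (fun a => form S (f a) (g a)) μ :=
  memLp_one_iff_integrable.1
    ((LinearMap.toContinuousBilinearMap (bilin S)).memLp_of_bilin 1 hf hg)

theorem integral_form_condExp {α : Type*} {m m0 : MeasurableSpace α} (hm : m ≤ m0) {μ : Measure α}
    [IsFiniteMeasure μ] {f g : α → Space d} (hfm : StronglyMeasurable[m] f) (hf : MemLp f 2 μ)
    (hg : MemLp g 2 μ) :
    ∫ a, form S (f a) (g a) ∂μ = ∫ a, form S (f a) ((μ[g | m]) a) ∂μ := by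
  rw [← integral_condExp hm]
  exact integral_congr_ae (condExp_bilin_of_stronglyMeasurable_left
    (LinearMap.toContinuousBilinearMap (bilin S)) hfm (integrable_form hf hg)
    (hg.integrable (by norm_num)))

/-- A measure on pairs `(x, y)` with finite second moments for which the mean of `y` given `x` is
`x`, expressed through integrals over the sets `{x ∈ s}`. In this form the condition is additive in
the measure, and makes sense whatever the total mass. -/
structure IsMartingalePlan (γ : Measure (Space d × Space d)) : Prop where
  memLp_fst : MemLp Prod.fst 2 γ
  memLp_snd : MemLp Prod.snd 2 γ
  setIntegral_eq : ∀ s : Set (Space d), MeasurableSet s →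
    ∫ p in Prod.fst ⁻¹' s, p.2 ∂γ = ∫ p in Prod.fst ⁻¹' s, p.1 ∂γ

section Plans

variable {γ : Measure (Space d × Space d)} [IsFiniteMeasure γ]

theorem IsMartingalePlan.condExp_eq (h : IsMartingalePlan γ) :
    γ[(Prod.snd : Space d × Space d → Space d) | MeasurableSpace.comap Prod.fst inferInstance]
      =ᵐ[γ] Prod.fst := by
  refine (ae_eq_condExp_of_forall_setIntegral_eq measurable_fst.comap_le
    (h.memLp_snd.integrable (by norm_num))
    (fun s _ _ => (h.memLp_fst.integrable (by norm_num)).integrableOn) ?_ ?_).symm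
  · rintro _ ⟨s, hs, rfl⟩ -
    exact (h.setIntegral_eq s hs).symm
  · exact (comap_measurable
      (Prod.fst : Space d × Space d → Space d)).stronglyMeasurable.aestronglyMeasurable

theorem isMartingalePlan_of_condExp_eq (h1 : MemLp Prod.fst 2 γ) (h2 : MemLp Prod.snd 2 γ)
    (h : γ[(Prod.snd : Space d × Space d → Space d) |
      MeasurableSpace.comap Prod.fst inferInstance] =ᵐ[γ] Prod.fst) : IsMartingalePlan γ := by
  refine ⟨h1, h2, fun s hs => ?_⟩
  rw [← setIntegral_condExp measurable_fst.comap_le (h2.integrable (by norm_num)) ⟨s, hs, rfl⟩]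
  exact integral_congr_ae (ae_restrict_of_ae h)

theorem mem_feasiblePlans_iff {ν : Measure (Space d)} :
    γ ∈ feasiblePlans ν ↔ IsProbabilityMeasure γ ∧ IsMartingalePlan γ ∧ γ.map Prod.snd = ν := by
  constructor
  · rintro ⟨h1, h2, h3, h4⟩
    exact ⟨h1, isMartingalePlan_of_condExp_eq (h2.of_le measurable_fst.aestronglyMeasurable
      (ae_of_all _ fun p => norm_fst_le p)) (h2.of_le measurable_snd.aestronglyMeasurable
      (ae_of_all _ fun p => norm_snd_le p)) h4, h3⟩
  · rintro ⟨h1, h2, h3⟩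
    refine ⟨h1, ?_, h3, h2.condExp_eq⟩
    refine (h2.memLp_fst.norm.add h2.memLp_snd.norm).of_le aestronglyMeasurable_id
      (ae_of_all _ fun p => ?_)
    rw [Pi.add_apply, Real.norm_of_nonneg (by positivity)]
    exact max_le (le_add_of_nonneg_right (norm_nonneg _)) (le_add_of_nonneg_left (norm_nonneg _))

/-- Test functions of the first coordinate do not distinguish the two coordinates. -/
theorem IsMartingalePlan.integral_form (h : IsMartingalePlan γ) {u : Space d → Space d}
    (hu : Measurable u) (hu2 : MemLp (fun p : Space d × Space d => u p.1) 2 γ) :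
    ∫ p, form S (u p.1) p.2 ∂γ = ∫ p, form S (u p.1) p.1 ∂γ := by
  rw [integral_form_condExp (f := fun p : Space d × Space d => u p.1)
    (g := Prod.snd) measurable_fst.comap_le
    (hu.comp (comap_measurable Prod.fst)).stronglyMeasurable hu2 h.memLp_snd]
  refine integral_congr_ae ?_
  filter_upwards [h.condExp_eq] with p hp
  rw [hp]

theorem IsMartingalePlan.integral_form_fst (h : IsMartingalePlan γ) :
    ∫ p, form S p.1 p.2 ∂γ = ∫ p, form S p.1 p.1 ∂γ :=
  h.integral_form measurable_id h.memLp_fst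

/-- Half of the zero duality gap: a maximal monotone set whose Fitzpatrick function is not above
`S(x, y) - S(x, x) / 2` along the plan has a dual value not above the value of the plan. -/
theorem IsMartingalePlan.extExpectation_le (h : IsMartingalePlan γ)
    (hle : ∀ᵐ p ∂γ, fitzpatrick S G p.2 ≤
      ((form S p.1 p.2 - (1 / 2) * form S p.1 p.1 : ℝ) : EReal)) :
    extExpectation (γ.map Prod.snd) (fitzpatrick S G)
      ≤ (((1 / 2) * ∫ p, form S p.1 p.2 ∂γ : ℝ) : EReal) := by
  rw [extExpectation_map measurable_snd measurable_fitzpatrick]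
  refine (extExpectation_mono hle).trans ?_
  have h1 : Integrable (fun p => form S p.1 p.2) γ := integrable_form h.memLp_fst h.memLp_snd
  have h2 : Integrable (fun p : Space d × Space d => (1 / 2) * form S p.1 p.1) γ :=
    (integrable_form h.memLp_fst h.memLp_fst).const_mul _
  have h3 : Integrable (fun p : Space d × Space d =>
      form S p.1 p.2 - (1 / 2) * form S p.1 p.1) γ := h1.sub h2
  rw [extExpectation_coe h3, integral_sub h1 h2, integral_const_mul,
    ← h.integral_form_fst, EReal.coe_le_coe_iff]
  linarith

/-- Complementary slackness: if the dual value of a maximal monotone set is not above the value of a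
plan, the plan is carried by the graph of the projection. The Fitzpatrick function
at `y` is bounded from below by the affine function of `y` that belongs to the point of `G` lying
over `x` along the negative eigenspace. -/
theorem IsMartingalePlan.ae_mem_proj (F : FundamentalSymmetry (bilin S)) (hS : S.IsHermitian)
    (hG : G ∈ maximalMonotoneSets S) (h : IsMartingalePlan γ)
    (hle : extExpectation (γ.map Prod.snd) (fitzpatrick S G)
      ≤ (((1 / 2) * ∫ p, form S p.1 p.2 ∂γ : ℝ) : EReal)) :
    ∀ᵐ p ∂γ, p.1 ∈ proj S G p.2 := by
  obtain ⟨f, ⟨K, hK⟩, hf⟩ := exists_lipschitz_selection F hG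
  have hf2 : MemLp (fun p : Space d × Space d => f p.1) 2 γ := by
    have ha : MemLp (fun _ : Space d × Space d => ‖f 0‖) 2 γ := memLp_const _
    have hb : MemLp (fun p : Space d × Space d => ‖p.1‖) 2 γ := h.memLp_fst.norm
    have h0 := ha.add (hb.const_mul (K : ℝ))
    have hc : Continuous fun p : Space d × Space d => f p.1 := hK.continuous.comp continuous_fst
    refine h0.of_le hc.aestronglyMeasurable (ae_of_all _ fun p => ?_)
    rw [Pi.add_apply, Real.norm_of_nonneg (by positivity)]
    have h1 := hK.dist_le_mul p.1 0
    rw [dist_zero_right, dist_eq_norm] at h1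
    have h2 := norm_le_norm_add_norm_sub' (f p.1) (f 0)
    linarith
  have hi1 : Integrable (fun p : Space d × Space d => form S (f p.1) p.2) γ :=
    integrable_form hf2 h.memLp_snd
  have hi2 : Integrable (fun p : Space d × Space d => form S (f p.1) p.1) γ :=
    integrable_form hf2 h.memLp_fst
  have hi3 : Integrable (fun p : Space d × Space d => (1 / 2) * form S (f p.1) (f p.1)) γ :=
    (integrable_form hf2 hf2).const_mul _
  have hi4 : Integrable (fun p : Space d × Space d => form S p.1 p.1) γ :=
    integrable_form h.memLp_fst h.memLp_fst
  have hi5 : Integrable (fun p : Space d × Space d => form S (f p.1 - p.1) (f p.1 - p.1)) γ :=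
    integrable_form (hf2.sub h.memLp_fst) (hf2.sub h.memLp_fst)
  have hi6 : Integrable (fun p : Space d × Space d =>
      form S (f p.1) p.2 - (1 / 2) * form S (f p.1) (f p.1)) γ := hi1.sub hi3
  have hneg : ∀ x, form S (f x - x) (f x - x) ≤ 0 := by
    intro x
    have h1 := F.nonneg (f x - x)
    rw [(hf x).2, map_neg, LinearMap.neg_apply] at h1
    exact neg_nonneg.1 h1
  have hval : ∫ p, (form S (f p.1) p.2 - (1 / 2) * form S (f p.1) (f p.1)) ∂γ
      = (1 / 2) * ∫ p, form S p.1 p.2 ∂γ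
        - (1 / 2) * ∫ p, form S (f p.1 - p.1) (f p.1 - p.1) ∂γ := by
    rw [integral_sub hi1 hi3, h.integral_form hK.continuous.measurable hf2,
      ← integral_sub hi2 hi3, h.integral_form_fst, ← integral_const_mul, ← integral_const_mul,
      ← integral_sub (hi4.const_mul _) (hi5.const_mul _)]
    refine integral_congr_ae (ae_of_all _ fun p => ?_)
    simp only [form_sub_self hS]
    ring
  have hint : ∫ p, form S (f p.1 - p.1) (f p.1 - p.1) ∂γ ≤ 0 :=
    integral_nonpos fun p => hneg p.1
  rw [extExpectation_map measurable_snd measurable_fitzpatrick] at hle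
  have hae := ae_eq_of_extExpectation_le (measurable_fitzpatrick.comp measurable_snd)
    hi6 (ae_of_all _ fun p => le_fitzpatrick (hf p.1).1 p.2)
    (hle.trans (by
      rw [EReal.coe_le_coe_iff, hval]
      linarith))
  have hzero : ∫ p, form S (f p.1 - p.1) (f p.1 - p.1) ∂γ = 0 := by
    have h1 := extExpectation_mono (μ := γ) (Filter.EventuallyEq.le (hae.mono fun p hp => hp.symm))
    rw [extExpectation_coe hi6] at h1
    have h2 := EReal.coe_le_coe_iff.1 (h1.trans hle)
    rw [hval] at h2
    linarith
  have hae0 : ∀ᵐ p ∂γ, -form S (f p.1 - p.1) (f p.1 - p.1) = 0 := by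
    have hnn : 0 ≤ fun p : Space d × Space d => -form S (f p.1 - p.1) (f p.1 - p.1) :=
      fun p => neg_nonneg.2 (hneg p.1)
    have h0 : ∫ p, -form S (f p.1 - p.1) (f p.1 - p.1) ∂γ = 0 := by
      rw [integral_neg, hzero, neg_zero]
    have h1 := (integral_eq_zero_iff_of_nonneg hnn hi5.neg).1 h0
    filter_upwards [h1] with p hp
    rw [hp, Pi.zero_apply]
  filter_upwards [hae, hae0] with p hp hp0
  have h0 : f p.1 - p.1 = 0 := F.eq_zero_of_J_eq_neg (hf p.1).2 (by rw [bilin_apply]; linarith)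
  have h1 : f p.1 = p.1 := sub_eq_zero.1 h0
  refine mem_proj_of_fitzpatrick_le hS (h1 ▸ (hf p.1).1) (le_of_eq ?_)
  simp only [Function.comp_apply, h1] at hp
  exact hp

end Plans

/-! ### Maps and plans -/

section Maps

variable {Ω : Type*} [MeasurableSpace Ω] {P : Measure Ω} {X Y : Ω → Space d}

theorem isMartingalePlan_map_iff (hX : Measurable X) (hY : Measurable Y) :
    IsMartingalePlan (P.map fun ω => (X ω, Y ω)) ↔ MemLp X 2 P ∧ MemLp Y 2 P ∧
      ∀ s : Set (Space d), MeasurableSet s → ∫ ω in X ⁻¹' s, Y ω ∂P = ∫ ω in X ⁻¹' s, X ω ∂P := by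
  have hT : Measurable fun ω => (X ω, Y ω) := hX.prodMk hY
  have h1 : MemLp (Prod.fst : Space d × Space d → Space d) 2 (P.map fun ω => (X ω, Y ω))
      ↔ MemLp X 2 P := memLp_map_measure_iff measurable_fst.aestronglyMeasurable hT.aemeasurable
  have h2 : MemLp (Prod.snd : Space d × Space d → Space d) 2 (P.map fun ω => (X ω, Y ω))
      ↔ MemLp Y 2 P := memLp_map_measure_iff measurable_snd.aestronglyMeasurable hT.aemeasurable
  have h3 : ∀ s : Set (Space d), MeasurableSet s →
      ∫ p in Prod.fst ⁻¹' s, p.1 ∂(P.map fun ω => (X ω, Y ω)) = ∫ ω in X ⁻¹' s, X ω ∂P := fun s hs =>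
    setIntegral_map (measurable_fst hs) measurable_fst.aestronglyMeasurable hT.aemeasurable
  have h4 : ∀ s : Set (Space d), MeasurableSet s →
      ∫ p in Prod.fst ⁻¹' s, p.2 ∂(P.map fun ω => (X ω, Y ω)) = ∫ ω in X ⁻¹' s, Y ω ∂P := fun s hs =>
    setIntegral_map (measurable_fst hs) measurable_snd.aestronglyMeasurable hT.aemeasurable
  constructor
  · rintro ⟨a1, a2, a3⟩
    exact ⟨h1.1 a1, h2.1 a2, fun s hs => by rw [← h3 s hs, ← h4 s hs, a3 s hs]⟩
  · rintro ⟨a1, a2, a3⟩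
    exact ⟨h1.2 a1, h2.2 a2, fun s hs => by rw [h3 s hs, h4 s hs, a3 s hs]⟩

theorem map_mem_feasiblePlans_iff [IsProbabilityMeasure P] (hX : Measurable X) (hY : Measurable Y)
    (hY2 : MemLp Y 2 P) :
    (P.map fun ω => (X ω, Y ω)) ∈ feasiblePlans (P.map Y) ↔
      MemLp X 2 P ∧ P[Y | MeasurableSpace.comap X inferInstance] =ᵐ[P] X := by
  have hT : Measurable fun ω => (X ω, Y ω) := hX.prodMk hY
  have hprob : IsProbabilityMeasure (P.map fun ω => (X ω, Y ω)) :=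
    Measure.isProbabilityMeasure_map hT.aemeasurable
  rw [mem_feasiblePlans_iff, isMartingalePlan_map_iff hX hY, Measure.map_map measurable_snd hT]
  constructor
  · rintro ⟨-, ⟨h1, -, h2⟩, -⟩
    refine ⟨h1, (ae_eq_condExp_of_forall_setIntegral_eq hX.comap_le
      (hY2.integrable (by norm_num))
      (fun s _ _ => (h1.integrable (by norm_num)).integrableOn) ?_ ?_).symm⟩
    · rintro _ ⟨s, hs, rfl⟩ -
      exact (h2 s hs).symm
    · exact (comap_measurable X).stronglyMeasurable.aestronglyMeasurable
  · rintro ⟨h1, h2⟩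
    refine ⟨hprob, ⟨h1, hY2, fun s hs => ?_⟩, rfl⟩
    rw [← setIntegral_condExp hX.comap_le (hY2.integrable (by norm_num)) ⟨s, hs, rfl⟩]
    exact integral_congr_ae (ae_restrict_of_ae h2)

theorem integral_form_map (hX : Measurable X) (hY : Measurable Y) :
    ∫ p, form S p.1 p.2 ∂(P.map fun ω => (X ω, Y ω)) = ∫ ω, form S (X ω) (Y ω) ∂P :=
  integral_map (hX.prodMk hY).aemeasurable
    (continuous_form continuous_fst continuous_snd).aestronglyMeasurable

end Maps

end

/-! ### First variation of an optimal plan -/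

section


variable {d : ℕ} {S : Matrix (Fin d) (Fin d) ℝ}

theorem integral_withDensity_ofReal {α E : Type*} [MeasurableSpace α] [NormedAddCommGroup E]
    [NormedSpace ℝ E] {μ : Measure α} {w : α → ℝ} (hw : Measurable w) (h0 : ∀ a, 0 ≤ w a)
    (g : α → E) :
    ∫ a, g a ∂(μ.withDensity fun a => ENNReal.ofReal (w a)) = ∫ a, w a • g a ∂μ := by
  rw [integral_withDensity_eq_integral_toReal_smul (by fun_prop) (by simp)]
  simp only [ENNReal.toReal_ofReal (h0 _)]

theorem withDensity_ofReal_le_smul {α : Type*} [MeasurableSpace α] {μ : Measure α} {w : α → ℝ}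
    {c : ℝ} (hc : ∀ a, w a ≤ c) :
    μ.withDensity (fun a => ENNReal.ofReal (w a)) ≤ ENNReal.ofReal c • μ := by
  rw [← withDensity_const]
  exact withDensity_mono (ae_of_all _ fun a => ENNReal.ofReal_le_ofReal (hc a))

theorem memLp_two_add_measure {α E : Type*} [MeasurableSpace α] [NormedAddCommGroup E]
    {μ ν : Measure α} {f : α → E} (hμ : MemLp f 2 μ) (hν : MemLp f 2 ν) : MemLp f 2 (μ + ν) := by
  have h := hμ.1.add_measure hν.1
  rw [memLp_two_iff_integrable_sq_norm h]
  exact ((memLp_two_iff_integrable_sq_norm hμ.1).1 hμ).add_measure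
    ((memLp_two_iff_integrable_sq_norm hν.1).1 hν)

theorem IsMartingalePlan.add {γ η : Measure (Space d × Space d)} [IsFiniteMeasure γ]
    [IsFiniteMeasure η] (hγ : IsMartingalePlan γ) (hη : IsMartingalePlan η) :
    IsMartingalePlan (γ + η) := by
  refine ⟨memLp_two_add_measure hγ.memLp_fst hη.memLp_fst,
    memLp_two_add_measure hγ.memLp_snd hη.memLp_snd, fun s hs => ?_⟩
  rw [Measure.restrict_add,
    integral_add_measure (hγ.memLp_snd.integrable (by norm_num)).integrableOn
      (hη.memLp_snd.integrable (by norm_num)).integrableOn,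
    integral_add_measure (hγ.memLp_fst.integrable (by norm_num)).integrableOn
      (hη.memLp_fst.integrable (by norm_num)).integrableOn,
    hγ.setIntegral_eq s hs, hη.setIntegral_eq s hs]

theorem isMartingalePlan_map_condExp {α : Type*} {m m0 : MeasurableSpace α} (hm : m ≤ m0)
    {μ : Measure α} [IsFiniteMeasure μ] {X Y : α → Space d} (hY : Measurable Y) (hY2 : MemLp Y 2 μ)
    (hX : Measurable[m] X) (hXY : X =ᵐ[μ] μ[Y | m]) :
    IsMartingalePlan (μ.map fun a => (X a, Y a)) := by
  rw [isMartingalePlan_map_iff (hX.mono hm le_rfl) hY]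
  refine ⟨(hY2.condExp (by norm_num)).ae_eq hXY.symm, hY2, fun s hs => ?_⟩
  rw [← setIntegral_condExp hm (hY2.integrable (by norm_num)) (hX hs)]
  exact integral_congr_ae (ae_restrict_of_ae hXY.symm)

theorem isMartingalePlan_map_const {α : Type*} [MeasurableSpace α] {μ : Measure α}
    [IsFiniteMeasure μ] {Y : α → Space d} (hY : Measurable Y) (hY2 : MemLp Y 2 μ) {x : Space d}
    (hx : ∫ a, Y a ∂μ = μ.real Set.univ • x) :
    IsMartingalePlan (μ.map fun a => (x, Y a)) := by
  rw [isMartingalePlan_map_iff (X := fun _ => x) measurable_const hY]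
  refine ⟨memLp_const _, hY2, fun s hs => ?_⟩
  by_cases hxs : x ∈ s <;> simp [hxs, hx]

theorem form_one_self (x : Space d) : form 1 x x = ‖x‖ ^ 2 := by
  rw [form_eq_inner, Matrix.one_mulVec]
  exact real_inner_self_eq_norm_sq x

theorem abs_form_one_le (x y : Space d) : |form 1 x y| ≤ ‖x‖ * ‖y‖ := by
  rw [form_eq_inner, Matrix.one_mulVec]
  exact abs_real_inner_le_norm x y

theorem exists_abs_form_le (S : Matrix (Fin d) (Fin d) ℝ) :
    ∃ c, 0 ≤ c ∧ ∀ x y, |form S x y| ≤ c * (‖x‖ * ‖y‖) :=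
  ⟨‖LinearMap.toContinuousBilinearMap (bilin S)‖, by positivity, fun x y => by
    rw [← mul_assoc]
    exact (LinearMap.toContinuousBilinearMap (bilin S)).le_opNorm₂ x y⟩

/-- Lowering the density of a martingale plan from `1` to `1 - ρ`, where `ρ ≤ δ ≤ 1 / 2`, moves the
conditional mean of `y` given `x` by `O(δ)` in the mean square. For the displacement
`D(x) = F(x) - x`, the martingale property of both measures gives
`∫ (1 - ρ) ‖D‖² = ∫ (1 - ρ) ⟨D, y - x⟩ = -∫ ρ ⟨D, y - x⟩`. -/
theorem IsMartingalePlan.integral_displacement_le {γ : Measure (Space d × Space d)}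
    [IsFiniteMeasure γ] (h : IsMartingalePlan γ) {ρ : Space d × Space d → ℝ} (hρ : Measurable ρ)
    {δ : ℝ} (h0 : ∀ p, 0 ≤ ρ p) (h1 : ∀ p, ρ p ≤ δ) (hδ : δ ≤ 1 / 2) {F : Space d → Space d}
    (hF : Measurable F)
    (hFγ : (fun p : Space d × Space d => F p.1)
      =ᵐ[γ.withDensity fun p => ENNReal.ofReal (1 - ρ p)]
      (γ.withDensity fun p => ENNReal.ofReal (1 - ρ p))[Prod.snd |
        MeasurableSpace.comap Prod.fst inferInstance]) :
    ∫ p, ‖F p.1 - p.1‖ ^ 2 ∂(γ.withDensity fun p => ENNReal.ofReal (1 - ρ p))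
      ≤ 2 * δ ^ 2 * ∫ p, ‖p.2 - p.1‖ ^ 2 ∂γ := by
  set μ := γ.withDensity fun p => ENNReal.ofReal (1 - ρ p) with hμ
  have hw0 : ∀ p, 0 ≤ 1 - ρ p := fun p => by linarith [h1 p]
  have hwm : Measurable fun p => 1 - ρ p := measurable_const.sub hρ
  have hμle : μ ≤ ENNReal.ofReal 1 • γ := withDensity_ofReal_le_smul fun p => by linarith [h0 p]
  have hleμ : γ ≤ (2 : ENNReal) • μ := by
    rw [hμ, ← withDensity_smul _ (by fun_prop)]
    conv_lhs => rw [← withDensity_one (μ := γ)]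
    refine withDensity_mono (ae_of_all _ fun p => ?_)
    simp only [Pi.one_apply, Pi.smul_apply, smul_eq_mul]
    rw [← ENNReal.ofReal_ofNat, ← ENNReal.ofReal_mul (by norm_num), ← ENNReal.ofReal_one]
    exact ENNReal.ofReal_le_ofReal (by linarith [h1 p])
  have : IsFiniteMeasure μ := by
    refine ⟨(hμle Set.univ).trans_lt ?_⟩
    simp
  have hfst : MemLp (Prod.fst : Space d × Space d → Space d) 2 μ :=
    h.memLp_fst.of_measure_le_smul ENNReal.ofReal_ne_top hμle
  have hsnd : MemLp (Prod.snd : Space d × Space d → Space d) 2 μ :=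
    h.memLp_snd.of_measure_le_smul ENNReal.ofReal_ne_top hμle
  have hFμ : MemLp (fun p : Space d × Space d => F p.1) 2 μ :=
    (hsnd.condExp (by norm_num)).ae_eq hFγ.symm
  have hD : MemLp (fun p : Space d × Space d => F p.1 - p.1) 2 μ := hFμ.sub hfst
  have hDγ : MemLp (fun p : Space d × Space d => F p.1 - p.1) 2 γ :=
    hD.of_measure_le_smul (by norm_num) hleμ
  have hE : MemLp (fun p : Space d × Space d => p.2 - p.1) 2 γ := h.memLp_snd.sub h.memLp_fst
  have hDm : Measurable fun x => F x - x := hF.sub measurable_id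
  -- the mean square displacement as a correlation with `y - x`
  have e1 : ∫ p, ‖F p.1 - p.1‖ ^ 2 ∂μ = ∫ p, form 1 (F p.1 - p.1) (p.2 - p.1) ∂μ := by
    have h2 := integral_form_condExp (S := 1) (f := fun p : Space d × Space d => F p.1 - p.1)
      measurable_fst.comap_le (hDm.comp (comap_measurable Prod.fst)).stronglyMeasurable hD hsnd
    have h3 : ∀ p : Space d × Space d, form 1 (F p.1 - p.1) (p.2 - p.1)
        = form 1 (F p.1 - p.1) p.2 - form 1 (F p.1 - p.1) p.1 := fun p => by
      rw [← bilin_apply, map_sub]; rfl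
    simp only [h3]
    rw [integral_sub (integrable_form hD hsnd) (integrable_form hD hfst), h2,
      ← integral_sub (integrable_form hD (hsnd.condExp (by norm_num))) (integrable_form hD hfst)]
    refine integral_congr_ae ?_
    filter_upwards [hFγ] with p hp
    rw [← hp, ← form_one_self, ← bilin_apply, map_sub (bilin 1 (F p.1 - p.1))]
    rfl
  have e2 : ∫ p, form 1 (F p.1 - p.1) (p.2 - p.1) ∂γ = 0 := by
    have h3 : ∀ p : Space d × Space d, form 1 (F p.1 - p.1) (p.2 - p.1)
        = form 1 (F p.1 - p.1) p.2 - form 1 (F p.1 - p.1) p.1 := fun p => by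
      rw [← bilin_apply, map_sub]; rfl
    simp only [h3]
    rw [integral_sub (integrable_form hDγ h.memLp_snd) (integrable_form hDγ h.memLp_fst),
      h.integral_form hDm hDγ, sub_self]
  have hI : Integrable (fun p : Space d × Space d => form 1 (F p.1 - p.1) (p.2 - p.1)) γ :=
    integrable_form hDγ hE
  have hρI : Integrable
      (fun p : Space d × Space d => ρ p * form 1 (F p.1 - p.1) (p.2 - p.1)) γ :=
    hI.bdd_mul (c := δ) hρ.aestronglyMeasurable
      (ae_of_all _ fun p => by rw [Real.norm_of_nonneg (h0 p)]; exact h1 p)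
  have hD2 : Integrable (fun p : Space d × Space d => ‖F p.1 - p.1‖ ^ 2) γ :=
    (memLp_two_iff_integrable_sq_norm hDγ.1).1 hDγ
  have hE2 : Integrable (fun p : Space d × Space d => ‖p.2 - p.1‖ ^ 2) γ :=
    (memLp_two_iff_integrable_sq_norm hE.1).1 hE
  have hρD : Integrable (fun p : Space d × Space d => ρ p * ‖F p.1 - p.1‖ ^ 2) γ :=
    hD2.bdd_mul (c := δ) hρ.aestronglyMeasurable
      (ae_of_all _ fun p => by rw [Real.norm_of_nonneg (h0 p)]; exact h1 p)
  have e3 : ∫ p, form 1 (F p.1 - p.1) (p.2 - p.1) ∂μ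
      = -∫ p, ρ p * form 1 (F p.1 - p.1) (p.2 - p.1) ∂γ := by
    rw [hμ, integral_withDensity_ofReal hwm hw0]
    simp only [smul_eq_mul, sub_mul, one_mul]
    rw [integral_sub hI hρI, e2, zero_sub]
  have e4 : ∫ p, ‖F p.1 - p.1‖ ^ 2 ∂γ ≤ 2 * ∫ p, ‖F p.1 - p.1‖ ^ 2 ∂μ := by
    rw [hμ, integral_withDensity_ofReal hwm hw0, ← integral_const_mul]
    have h5 : Integrable
        (fun p : Space d × Space d => 2 * ((1 - ρ p) • ‖F p.1 - p.1‖ ^ 2)) γ := by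
      simp only [smul_eq_mul, sub_mul, one_mul]
      exact (hD2.sub hρD).const_mul 2
    refine integral_mono hD2 h5 fun p => ?_
    have := mul_nonneg (by linarith [h1 p] : 0 ≤ 1 - 2 * ρ p) (sq_nonneg ‖F p.1 - p.1‖)
    simp only [smul_eq_mul]
    linarith
  have e5 : -∫ p, ρ p * form 1 (F p.1 - p.1) (p.2 - p.1) ∂γ
      ≤ (1 / 4) * ∫ p, ‖F p.1 - p.1‖ ^ 2 ∂γ + δ ^ 2 * ∫ p, ‖p.2 - p.1‖ ^ 2 ∂γ := by
    rw [← integral_neg, ← integral_const_mul, ← integral_const_mul,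
      ← integral_add (hD2.const_mul _) (hE2.const_mul _)]
    refine integral_mono hρI.neg ((hD2.const_mul _).add (hE2.const_mul _)) fun p => ?_
    have h6 := abs_form_one_le (F p.1 - p.1) (p.2 - p.1)
    have h7 : -(ρ p * form 1 (F p.1 - p.1) (p.2 - p.1))
        ≤ δ * (‖F p.1 - p.1‖ * ‖p.2 - p.1‖) := by
      refine (neg_le_abs _).trans ?_
      rw [abs_mul, abs_of_nonneg (h0 p)]
      exact mul_le_mul (h1 p) h6 (abs_nonneg _) ((h0 p).trans (h1 p))
    refine h7.trans ?_
    nlinarith [sq_nonneg (‖F p.1 - p.1‖ / 2 - δ * ‖p.2 - p.1‖)]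
  linarith

/-- **First variation of an optimal plan.** A small mass, distributed as `ε ρ`, is taken from the
plan and attached to the single point `∫ ρ y`, its barycenter; for the rest of the mass `x` is
replaced by the conditional mean of `y`. The result is a feasible plan. By
`IsMartingalePlan.integral_displacement_le` the second step changes the value to the first order in
`ε` only through the loss of mass. -/
theorem IsOptimalPlan.first_variation {ν : Measure (Space d)} {γ : Measure (Space d × Space d)}
    (hγ : IsOptimalPlan S ν γ) (hS : S.IsHermitian) {ρ : Space d × Space d → ℝ}
    (hρ : Measurable ρ) {B : ℝ} (h0 : ∀ p, 0 ≤ ρ p) (hB : ∀ p, ρ p ≤ B) (h1 : ∫ p, ρ p ∂γ = 1) :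
    form S (∫ p, ρ p • p.2 ∂γ) (∫ p, ρ p • p.2 ∂γ) / 2
      ≤ ∫ p, ρ p * (form S p.1 p.2 - (1 / 2) * form S p.1 p.1) ∂γ := by
  have hprob : IsProbabilityMeasure γ := hγ.1.1
  obtain ⟨-, h, hν⟩ := mem_feasiblePlans_iff.1 hγ.1
  set b : Space d := ∫ p, ρ p • p.2 ∂γ with hb
  set c : Space d × Space d → ℝ := fun p => form S p.1 p.2 - (1 / 2) * form S p.1 p.1 with hc
  obtain ⟨K, hK0, hK⟩ := exists_abs_form_le S
  have hB0 : 0 ≤ B := (h0 0).trans (hB 0)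
  set M := ∫ p, ‖p.2 - p.1‖ ^ 2 ∂γ with hM
  -- the estimate for the mass `ε`
  have key : ∀ ε : ℝ, 0 < ε → ε * B ≤ 1 / 2 →
      form S b b / 2 - ∫ p, ρ p * c p ∂γ ≤ ε * (K * B ^ 2 * M) := by
    intro ε hε hεB
    have hρm : Measurable fun p => ε * ρ p := hρ.const_mul ε
    have hρ0 : ∀ p, 0 ≤ ε * ρ p := fun p => mul_nonneg hε.le (h0 p)
    have hρB : ∀ p, ε * ρ p ≤ ε * B := fun p => mul_le_mul_of_nonneg_left (hB p) hε.le
    have hw0 : ∀ p, 0 ≤ 1 - ε * ρ p := fun p => by linarith [hρB p]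
    have hwm : Measurable fun p => 1 - ε * ρ p := measurable_const.sub hρm
    set μ := γ.withDensity fun p => ENNReal.ofReal (1 - ε * ρ p) with hμ
    set θ := γ.withDensity fun p => ENNReal.ofReal (ε * ρ p) with hθ
    have hμle : μ ≤ ENNReal.ofReal 1 • γ :=
      withDensity_ofReal_le_smul fun p => by linarith [hρ0 p]
    have hθle : θ ≤ ENNReal.ofReal (ε * B) • γ := withDensity_ofReal_le_smul hρB
    have hμfin : IsFiniteMeasure μ := by
      refine ⟨(hμle Set.univ).trans_lt ?_⟩
      simp
    have hθfin : IsFiniteMeasure θ := by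
      refine ⟨(hθle Set.univ).trans_lt ?_⟩
      simp
    have hsum : μ + θ = γ := by
      rw [hμ, hθ, ← withDensity_add_left (by fun_prop)]
      conv_rhs => rw [← withDensity_one (μ := γ)]
      congr 1
      ext p
      rw [Pi.add_apply, ← ENNReal.ofReal_add (hw0 p) (hρ0 p), sub_add_cancel, ENNReal.ofReal_one,
        Pi.one_apply]
    have hfst : MemLp (Prod.fst : Space d × Space d → Space d) 2 μ :=
      h.memLp_fst.of_measure_le_smul ENNReal.ofReal_ne_top hμle
    have hsnd : MemLp (Prod.snd : Space d × Space d → Space d) 2 μ :=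
      h.memLp_snd.of_measure_le_smul ENNReal.ofReal_ne_top hμle
    have hsndθ : MemLp (Prod.snd : Space d × Space d → Space d) 2 θ :=
      h.memLp_snd.of_measure_le_smul ENNReal.ofReal_ne_top hθle
    obtain ⟨F, hFm, hF⟩ := (stronglyMeasurable_condExp (μ := μ)
      (f := (Prod.snd : Space d × Space d → Space d))
      (m := MeasurableSpace.comap Prod.fst inferInstance)).exists_eq_measurable_comp
    have hF' : (fun p : Space d × Space d => F p.1) =ᵐ[μ]
        μ[Prod.snd | MeasurableSpace.comap Prod.fst inferInstance] := by
      rw [hF]; rfl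
    have hθuniv : θ.real Set.univ = ε := by
      have h2 := integral_withDensity_ofReal (μ := γ) hρm hρ0 (fun _ => (1 : ℝ))
      simpa [integral_const_mul, h1] using h2
    have hθb : ∫ p, p.2 ∂θ = θ.real Set.univ • b := by
      rw [hθuniv, hθ, integral_withDensity_ofReal hρm hρ0, hb, ← integral_smul]
      simp only [mul_smul]
    have hP1 : IsMartingalePlan (μ.map fun p => (F p.1, p.2)) :=
      isMartingalePlan_map_condExp measurable_fst.comap_le measurable_snd hsnd
        (hFm.measurable.comp (comap_measurable Prod.fst)) hF'
    have hP2 : IsMartingalePlan (θ.map fun p => (b, p.2)) :=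
      isMartingalePlan_map_const measurable_snd hsndθ hθb
    have hT1 : Measurable fun p : Space d × Space d => (F p.1, p.2) :=
      (hFm.measurable.comp measurable_fst).prodMk measurable_snd
    have hT2 : Measurable fun p : Space d × Space d => (b, p.2) :=
      measurable_const.prodMk measurable_snd
    set η := (μ.map fun p => (F p.1, p.2)) + θ.map fun p => (b, p.2) with hη
    have hPη : IsMartingalePlan η := hP1.add hP2
    have hηsnd : η.map Prod.snd = ν := by
      rw [hη, Measure.map_add _ _ measurable_snd, Measure.map_map measurable_snd hT1,
        Measure.map_map measurable_snd hT2, ← hν, ← hsum, Measure.map_add _ _ measurable_snd]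
      rfl
    have hηprob : IsProbabilityMeasure η := by
      have h2 : IsProbabilityMeasure (η.map Prod.snd) := by
        rw [hηsnd, ← hν]
        exact Measure.isProbabilityMeasure_map measurable_snd.aemeasurable
      exact (Measure.isProbabilityMeasure_map_iff measurable_snd.aemeasurable).1 h2
    have hle := hγ.2 η (mem_feasiblePlans_iff.2 ⟨hηprob, hPη, hηsnd⟩)
    have hcont : Continuous fun p : Space d × Space d => form S p.1 p.1 :=
      continuous_form continuous_fst continuous_fst
    rw [hPη.integral_form_fst, hη, integral_add_measure
      (integrable_form hP1.memLp_fst hP1.memLp_fst) (integrable_form hP2.memLp_fst hP2.memLp_fst),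
      integral_map hT1.aemeasurable hcont.aestronglyMeasurable,
      integral_map hT2.aemeasurable hcont.aestronglyMeasurable] at hle
    change (1 / 2) * (∫ p, form S (F p.1) (F p.1) ∂μ + ∫ _, form S b b ∂θ) ≤ _ at hle
    rw [integral_const, hθuniv, smul_eq_mul] at hle
    have hFμ : MemLp (fun p : Space d × Space d => F p.1) 2 μ :=
      (hsnd.condExp (by norm_num)).ae_eq hF'.symm
    have hD : MemLp (fun p : Space d × Space d => F p.1 - p.1) 2 μ := hFμ.sub hfst
    have e1 : ∫ p, form S p.1 (F p.1) ∂μ = ∫ p, form S p.1 p.2 ∂μ := by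
      rw [integral_form_condExp (f := (Prod.fst : Space d × Space d → Space d)) (g := Prod.snd)
        measurable_fst.comap_le (comap_measurable Prod.fst).stronglyMeasurable hfst hsnd]
      refine integral_congr_ae ?_
      filter_upwards [hF'] with p hp
      rw [hp]
    have i1 : Integrable (fun p : Space d × Space d => form S p.1 p.2) μ := integrable_form hfst hsnd
    have i2 : Integrable (fun p : Space d × Space d => form S p.1 (F p.1)) μ :=
      integrable_form hfst hFμ
    have i3 : Integrable (fun p : Space d × Space d => form S p.1 p.1) μ :=
      integrable_form hfst hfst
    have i4 : Integrable (fun p : Space d × Space d => form S (F p.1 - p.1) (F p.1 - p.1)) μ :=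
      integrable_form hD hD
    have e2 : (1 / 2) * ∫ p, form S (F p.1) (F p.1) ∂μ
        = ∫ p, c p ∂μ + (1 / 2) * ∫ p, form S (F p.1 - p.1) (F p.1 - p.1) ∂μ := by
      have i5 : Integrable (fun p : Space d × Space d =>
          form S p.1 (F p.1) - (1 / 2) * form S p.1 p.1) μ := i2.sub (i3.const_mul _)
      rw [hc, integral_sub i1 (i3.const_mul _), ← e1, ← integral_sub i2 (i3.const_mul _),
        ← integral_const_mul, ← integral_const_mul, ← integral_add i5 (i4.const_mul _)]
      refine integral_congr_ae (ae_of_all _ fun p => ?_)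
      simp only [form_sub_self hS]
      rw [← bilin_apply S (F p.1) p.1, bilin_symm hS, bilin_apply]
      ring
    have ic : Integrable c γ := (integrable_form h.memLp_fst h.memLp_snd).sub
      ((integrable_form h.memLp_fst h.memLp_fst).const_mul _)
    have iρc : Integrable (fun p => ρ p * c p) γ :=
      ic.bdd_mul (c := B) hρ.aestronglyMeasurable
        (ae_of_all _ fun p => by rw [Real.norm_of_nonneg (h0 p)]; exact hB p)
    have e3 : ∫ p, c p ∂μ = ∫ p, c p ∂γ - ε * ∫ p, ρ p * c p ∂γ := by
      rw [hμ, integral_withDensity_ofReal hwm hw0, ← integral_const_mul,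
        ← integral_sub ic (iρc.const_mul _)]
      refine integral_congr_ae (ae_of_all _ fun p => ?_)
      simp only [smul_eq_mul]
      ring
    have e4 : ∫ p, c p ∂γ = (1 / 2) * ∫ p, form S p.1 p.2 ∂γ := by
      rw [hc, integral_sub (integrable_form h.memLp_fst h.memLp_snd)
        ((integrable_form h.memLp_fst h.memLp_fst).const_mul _), integral_const_mul,
        ← h.integral_form_fst]
      ring
    have e5 := h.integral_displacement_le hρm hρ0 hρB hεB hFm.measurable hF'
    have e6 : -∫ p, form S (F p.1 - p.1) (F p.1 - p.1) ∂μ ≤ K * ∫ p, ‖F p.1 - p.1‖ ^ 2 ∂μ := by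
      rw [← integral_neg, ← integral_const_mul]
      refine integral_mono i4.neg (((memLp_two_iff_integrable_sq_norm hD.1).1 hD).const_mul _)
        fun p => ?_
      have := hK (F p.1 - p.1) (F p.1 - p.1)
      rw [← sq] at this
      exact (neg_le_abs _).trans this
    have e7 := mul_le_mul_of_nonneg_left e5 hK0
    have e8 : ε * (form S b b / 2 - ∫ p, ρ p * c p ∂γ) ≤ ε * (ε * (K * B ^ 2 * M)) := by
      rw [← hM, ← hμ] at e7
      rw [mul_add, e2, e3, e4] at hle
      linarith
    exact le_of_mul_le_mul_left e8 hε
  by_contra! hlt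
  set a := form S b b / 2 - ∫ p, ρ p * c p ∂γ with ha
  have ha0 : 0 < a := by linarith
  have hM0 : 0 ≤ K * B ^ 2 * M := by
    have : 0 ≤ M := integral_nonneg fun p => by positivity
    positivity
  set N := K * B ^ 2 * M with hN
  have hε : 0 < min (1 / (2 * (B + 1))) (a / (2 * (N + 1))) := by positivity
  have h2 := key _ hε (by
    calc min (1 / (2 * (B + 1))) (a / (2 * (N + 1))) * B ≤ 1 / (2 * (B + 1)) * B := by
          gcongr; exact min_le_left _ _
      _ ≤ 1 / 2 := by
          rw [div_mul_eq_mul_div, div_le_div_iff₀ (by positivity) (by norm_num)]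
          linarith)
  have h3 : min (1 / (2 * (B + 1))) (a / (2 * (N + 1))) * N ≤ a / (2 * (N + 1)) * N := by
    gcongr; exact min_le_right _ _
  have h4 : a / (2 * (N + 1)) * N < a := by
    rw [div_mul_eq_mul_div, div_lt_iff₀ (by positivity)]
    nlinarith
  linarith

/-- The Fitzpatrick function of a suitable maximal monotone set supports an optimal plan. The pairs
`(∫ ρ y, ∫ ρ (S(x, y) - S(x, x) / 2))` form a convex set above the quadratic form `S(y, y) / 2`,
by the first variation; testing a set below them on indicator functions gives the pointwise
inequality. -/
theorem IsOptimalPlan.exists_maximalMonotoneSet {ν : Measure (Space d)}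
    {γ : Measure (Space d × Space d)} (hγ : IsOptimalPlan S ν γ)
    (F : FundamentalSymmetry (bilin S)) (hS : S.IsHermitian) :
    ∃ G ∈ maximalMonotoneSets S, ∀ᵐ p ∂γ, fitzpatrick S G p.2 ≤
      ((form S p.1 p.2 - (1 / 2) * form S p.1 p.1 : ℝ) : EReal) := by
  have hprob : IsProbabilityMeasure γ := hγ.1.1
  obtain ⟨-, h, hν⟩ := mem_feasiblePlans_iff.1 hγ.1
  set c : Space d × Space d → ℝ := fun p => form S p.1 p.2 - (1 / 2) * form S p.1 p.1 with hc
  have ic : Integrable c γ := (integrable_form h.memLp_fst h.memLp_snd).sub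
    ((integrable_form h.memLp_fst h.memLp_fst).const_mul _)
  have isnd : Integrable (Prod.snd : Space d × Space d → Space d) γ :=
    h.memLp_snd.integrable (by norm_num)
  have iρc : ∀ ρ : Space d × Space d → ℝ, Measurable ρ → (∀ p, 0 ≤ ρ p) → ∀ B, (∀ p, ρ p ≤ B) →
      Integrable (fun p => ρ p * c p) γ := fun ρ hρ h0 B hB =>
    ic.bdd_mul (c := B) hρ.aestronglyMeasurable
      (ae_of_all _ fun p => by rw [Real.norm_of_nonneg (h0 p)]; exact hB p)
  have iρ : ∀ ρ : Space d × Space d → ℝ, Measurable ρ → (∀ p, 0 ≤ ρ p) → ∀ B, (∀ p, ρ p ≤ B) →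
      Integrable (fun p => ρ p • p.2) γ := fun ρ hρ h0 B hB =>
    isnd.bdd_smul B hρ.aestronglyMeasurable
      (ae_of_all _ fun p => by rw [Real.norm_of_nonneg (h0 p)]; exact hB p)
  have iρ1 : ∀ ρ : Space d × Space d → ℝ, Measurable ρ → (∀ p, 0 ≤ ρ p) → ∀ B, (∀ p, ρ p ≤ B) →
      Integrable ρ γ := fun ρ hρ h0 B hB =>
    (integrable_const B).mono' hρ.aestronglyMeasurable
      (ae_of_all _ fun p => by rw [Real.norm_of_nonneg (h0 p)]; exact hB p)
  set A : Set (Space d × ℝ) := {z | ∃ ρ : Space d × Space d → ℝ, Measurable ρ ∧ (∀ p, 0 ≤ ρ p) ∧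
    (∃ B, ∀ p, ρ p ≤ B) ∧ ∫ p, ρ p ∂γ = 1 ∧
    z = (∫ p, ρ p • p.2 ∂γ, ∫ p, ρ p * c p ∂γ)} with hA
  have hAconv : Convex ℝ A := by
    rintro _ ⟨ρ, hρ, h0, ⟨B, hB⟩, h1, rfl⟩ _ ⟨ρ', hρ', h0', ⟨B', hB'⟩, h1', rfl⟩ s t hs ht hst
    refine ⟨fun p => s * ρ p + t * ρ' p, by fun_prop,
      fun p => add_nonneg (mul_nonneg hs (h0 p)) (mul_nonneg ht (h0' p)), ⟨s * B + t * B', fun p =>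
        add_le_add (mul_le_mul_of_nonneg_left (hB p) hs) (mul_le_mul_of_nonneg_left (hB' p) ht)⟩,
      ?_, ?_⟩
    · rw [integral_add ((iρ1 ρ hρ h0 B hB).const_mul _) ((iρ1 ρ' hρ' h0' B' hB').const_mul _),
        integral_const_mul, integral_const_mul, h1, h1', mul_one, mul_one, hst]
    · simp only [add_smul, mul_smul, add_mul, mul_assoc, Prod.smul_mk, Prod.mk_add_mk, smul_eq_mul]
      have i1 : Integrable (fun p => s • ρ p • p.2) γ := (iρ ρ hρ h0 B hB).smul s
      have i2 : Integrable (fun p => t • ρ' p • p.2) γ := (iρ ρ' hρ' h0' B' hB').smul t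
      rw [integral_add i1 i2,
        integral_add ((iρc ρ hρ h0 B hB).const_mul s) ((iρc ρ' hρ' h0' B' hB').const_mul t),
        integral_smul, integral_smul, integral_const_mul, integral_const_mul]
  have hAsub : A ⊆ quadEpigraph (bilin S) := by
    rintro _ ⟨ρ, hρ, h0, ⟨B, hB⟩, h1, rfl⟩
    exact hγ.first_variation hS hρ h0 hB h1
  have hAne : A.Nonempty :=
    ⟨_, fun _ => 1, measurable_const, fun _ => zero_le_one, ⟨1, fun _ => le_rfl⟩, by simp, rfl⟩
  obtain ⟨G, hmon, hGA, htouch, -⟩ := exists_monotone_of_convex F hAconv hAsub hAne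
  refine ⟨G, mem_maximalMonotoneSets_of_touching F hmon htouch, ?_⟩
  have hone : ∀ x ∈ G, ∀ᵐ p ∂γ, form S x p.2 - (1 / 2) * form S x x ≤ c p := by
    intro x hx
    have ix : Integrable (fun p : Space d × Space d => form S x p.2) γ :=
      integrable_form (memLp_const x) h.memLp_snd
    have ig : Integrable (fun p : Space d × Space d =>
        c p - (form S x p.2 - (1 / 2) * form S x x)) γ :=
      ic.sub (ix.sub (integrable_const _))
    have hnn := ae_nonneg_of_forall_setIntegral_nonneg ig fun s hs _ => by
      rcases eq_or_ne (γ.real s) 0 with h0 | h0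
      · rw [Measure.restrict_eq_zero.2 ((measureReal_eq_zero_iff).1 h0), integral_zero_measure]
      have hpos : 0 < γ.real s := lt_of_le_of_ne measureReal_nonneg h0.symm
      set ρ : Space d × Space d → ℝ := s.indicator fun _ => (γ.real s)⁻¹ with hρ
      have hρm : Measurable ρ := measurable_const.indicator hs
      have hρ0 : ∀ p, 0 ≤ ρ p := fun p => Set.indicator_nonneg (fun _ _ => by positivity) p
      have hρB : ∀ p, ρ p ≤ (γ.real s)⁻¹ := fun p =>
        Set.indicator_le_self' (fun _ _ => by positivity) p
      have hρ1 : ∫ p, ρ p ∂γ = 1 := by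
        rw [hρ, integral_indicator hs, setIntegral_const, smul_eq_mul, mul_inv_cancel₀ h0]
      have h2 := hGA _ ⟨ρ, hρm, hρ0, ⟨_, hρB⟩, hρ1, rfl⟩ x hx
      have h3 : bilin S x (∫ p, ρ p • p.2 ∂γ) = ∫ p, ρ p * form S x p.2 ∂γ := by
        have := (LinearMap.toContinuousBilinearMap (bilin S) x).integral_comp_comm
          (iρ ρ hρm hρ0 _ hρB)
        refine Eq.trans this.symm (integral_congr_ae (ae_of_all _ fun p => ?_))
        exact (bilin S x).map_smul (ρ p) p.2
      have iρx : Integrable (fun p => ρ p * form S x p.2) γ :=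
        ix.bdd_mul (c := (γ.real s)⁻¹) hρm.aestronglyMeasurable
          (ae_of_all _ fun p => by rw [Real.norm_of_nonneg (hρ0 p)]; exact hρB p)
      have h4 : ∫ p, ρ p * (c p - (form S x p.2 - (1 / 2) * form S x x)) ∂γ
          = ∫ p, ρ p * c p ∂γ - (∫ p, ρ p * form S x p.2 ∂γ - (1 / 2) * form S x x) := by
        have h5 : (1 / 2) * form S x x = ∫ p, (1 / 2) * form S x x * ρ p ∂γ := by
          rw [integral_const_mul, hρ1, mul_one]
        have i5 : Integrable (fun p => (1 / 2) * form S x x * ρ p) γ :=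
          (iρ1 ρ hρm hρ0 _ hρB).const_mul _
        have i6 : Integrable (fun p => ρ p * form S x p.2 - (1 / 2) * form S x x * ρ p) γ :=
          iρx.sub i5
        conv_rhs => rw [h5]
        rw [← integral_sub iρx i5, ← integral_sub (iρc ρ hρm hρ0 _ hρB) i6]
        exact integral_congr_ae (ae_of_all _ fun p => by ring)
      have h6 : ∫ p, ρ p * (c p - (form S x p.2 - (1 / 2) * form S x x)) ∂γ
          = (γ.real s)⁻¹ * ∫ p in s, (c p - (form S x p.2 - (1 / 2) * form S x x)) ∂γ := by
        rw [← integral_const_mul, ← integral_indicator hs]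
        refine integral_congr_ae (ae_of_all _ fun p => ?_)
        by_cases hp : p ∈ s <;> simp [hρ, hp]
      rw [h3, bilin_apply] at h2
      rw [h6] at h4
      refine nonneg_of_mul_nonneg_right ?_ (inv_pos.2 hpos)
      rw [h4]
      linarith
    filter_upwards [hnn] with p hp
    simp only [Pi.zero_apply] at hp
    linarith
  obtain ⟨D, hDG, hDc, hGD⟩ :=
    (TopologicalSpace.IsSeparable.of_separableSpace G).exists_countable_dense_subset
  have hall : ∀ᵐ p ∂γ, ∀ x ∈ D, form S x p.2 - (1 / 2) * form S x x ≤ c p :=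
    (ae_ball_iff hDc).2 fun x hx => hone x (hDG hx)
  filter_upwards [hall] with p hp
  refine iSup₂_le fun x hx => EReal.coe_le_coe_iff.2 ?_
  have hcl : IsClosed {x : Space d | form S x p.2 - (1 / 2) * form S x x ≤ c p} :=
    isClosed_le ((continuous_form continuous_id continuous_const).sub
      (continuous_const.mul (continuous_form continuous_id continuous_id))) continuous_const
  have hsub : closure D ⊆ {x : Space d | form S x p.2 - (1 / 2) * form S x x ≤ c p} :=
    closure_minimal (fun x hx => hp x hx) hcl
  have hmem := hsub (hGD hx)
  simp only [Set.mem_ofPred_eq] at hmem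
  exact hmem

end

/-! ### Compactness of the set of plans -/

section


section Continuity

open BoundedContinuousFunction

variable {X : Type*} [TopologicalSpace X] [MeasurableSpace X] [OpensMeasurableSpace X]

/-- The integral of a continuous function depends continuously on the probability measure, on a set
of measures for which the function is uniformly integrable. -/
theorem continuousOn_integral {K : Set (ProbabilityMeasure X)} {h : X → ℝ} (hc : Continuous h)
    (hint : ∀ γ ∈ K, Integrable h (γ : Measure X))
    (hui : ∀ ε > 0, ∃ R, 0 ≤ R ∧ ∀ γ ∈ K, ∫ x, max (|h x| - R) 0 ∂(γ : Measure X) ≤ ε) :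
    ContinuousOn (fun γ : ProbabilityMeasure X => ∫ x, h x ∂(γ : Measure X)) K := by
  refine continuousOn_of_uniform_approx_of_continuousOn fun u hu => ?_
  obtain ⟨ε, hε, hεu⟩ := Metric.mem_uniformity_dist.1 hu
  obtain ⟨R, hR, hRε⟩ := hui (ε / 2) (half_pos hε)
  have hb : ∀ x, ‖max (-R) (min (h x) R)‖ ≤ R := fun x => by
    rw [Real.norm_eq_abs, abs_le]
    exact ⟨le_max_left _ _, max_le (by linarith) (min_le_right _ _)⟩
  have hcc : Continuous fun x => max (-R) (min (h x) R) := by fun_prop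
  refine ⟨fun γ => ∫ x, max (-R) (min (h x) R) ∂(γ : Measure X), ?_, fun γ hγ => hεu ?_⟩
  · exact (ProbabilityMeasure.continuous_integral_boundedContinuousFunction
      (BoundedContinuousFunction.ofNormedAddCommGroup _ hcc R hb)).continuousOn
  · have hi : Integrable (fun x => max (-R) (min (h x) R)) (γ : Measure X) :=
      (integrable_const R).mono' hcc.aestronglyMeasurable (ae_of_all _ hb)
    rw [Real.dist_eq, ← integral_sub (hint γ hγ) hi]
    refine lt_of_le_of_lt ((abs_integral_le_integral_abs).trans (le_trans (le_of_eq ?_) (hRε γ hγ)))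
      (half_lt_self hε)
    refine integral_congr_ae (ae_of_all _ fun x => ?_)
    simp only
    rcases le_total (h x) R with h1 | h1
    · rcases le_total (-R) (h x) with h2 | h2
      · rw [min_eq_left h1, max_eq_right h2, max_eq_right (by linarith [abs_le.2 ⟨h2, h1⟩]), sub_self,
          abs_zero]
      · rw [min_eq_left h1, max_eq_left h2, abs_of_nonpos (by linarith : h x ≤ 0),
          abs_of_nonpos (by linarith), max_eq_left (by linarith)]
        ring
    · rw [min_eq_right h1, max_eq_right (by linarith), abs_of_nonneg (by linarith),
        abs_of_nonneg (by linarith), max_eq_left (by linarith)]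

end Continuity

theorem integrable_of_integral_min_le {X : Type*} [MeasurableSpace X] {μ : Measure X}
    [IsFiniteMeasure μ] {f : X → ℝ} (hf : Measurable f) (h0 : ∀ x, 0 ≤ f x) {M : ℝ}
    (h : ∀ n : ℕ, ∫ x, min (f x) n ∂μ ≤ M) : Integrable f μ := by
  have h1 : ∫⁻ x, ENNReal.ofReal (f x) ∂μ ≤ ENNReal.ofReal M := by
    have h2 : ∀ x, ENNReal.ofReal (f x) = ⨆ n : ℕ, ENNReal.ofReal (min (f x) n) := by
      intro x
      refine le_antisymm ?_ (iSup_le fun n => ENNReal.ofReal_le_ofReal (min_le_left _ _))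
      obtain ⟨n, hn⟩ := exists_nat_ge (f x)
      refine le_iSup_of_le n ?_
      rw [min_eq_left hn]
    simp only [h2]
    have hmeas : ∀ n : ℕ, Measurable fun x => ENNReal.ofReal (min (f x) n) := fun n => by fun_prop
    have hmono : Monotone fun (n : ℕ) x => ENNReal.ofReal (min (f x) n) := fun m n hmn x =>
      ENNReal.ofReal_le_ofReal (min_le_min_left _ (by exact_mod_cast hmn))
    rw [lintegral_iSup hmeas hmono]
    refine iSup_le fun n => ?_
    have h3 : ∀ x, 0 ≤ min (f x) (n : ℝ) := fun x => le_min (h0 x) (by positivity)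
    rw [← ofReal_integral_eq_lintegral_ofReal _ (ae_of_all _ h3)]
    · exact ENNReal.ofReal_le_ofReal (h n)
    · exact (integrable_const (n : ℝ)).mono' (by fun_prop) (ae_of_all _ fun x => by
        rw [Real.norm_of_nonneg (h3 x)]; exact min_le_right _ _)
  refine ⟨hf.aestronglyMeasurable, ?_⟩
  rw [hasFiniteIntegral_iff_ofReal (ae_of_all _ h0)]
  exact h1.trans_lt ENNReal.ofReal_lt_top

variable {d : ℕ} {S : Matrix (Fin d) (Fin d) ℝ}

/-- Jensen's inequality for the convex function `(c ‖x‖² - R)⁺`. It gives both the bound of the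
second moment of the first marginal (`R = 0`) and the uniform integrability of `‖x‖²`. -/
theorem IsMartingalePlan.integral_truncated_sq_le {γ : Measure (Space d × Space d)}
    [IsFiniteMeasure γ] (h : IsMartingalePlan γ) {c : ℝ} (hc : 0 ≤ c) {R : ℝ} :
    ∫ p, max (c * ‖p.1‖ ^ 2 - R) 0 ∂γ ≤ ∫ p, max (c * ‖p.2‖ ^ 2 - R) 0 ∂γ := by
  have hi1 : Integrable (fun p : Space d × Space d => ‖p.1‖ ^ 2) γ :=
    (memLp_two_iff_integrable_sq_norm h.memLp_fst.1).1 h.memLp_fst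
  have hi2 : Integrable (fun p : Space d × Space d => ‖p.2‖ ^ 2) γ :=
    (memLp_two_iff_integrable_sq_norm h.memLp_snd.1).1 h.memLp_snd
  have hj1 : Integrable (fun p : Space d × Space d => max (c * ‖p.1‖ ^ 2 - R) 0) γ :=
    ((hi1.const_mul c).sub (integrable_const R)).pos_part
  have hj2 : Integrable (fun p : Space d × Space d => max (c * ‖p.2‖ ^ 2 - R) 0) γ :=
    ((hi2.const_mul c).sub (integrable_const R)).pos_part
  set s : Set (Space d) := {x | R < c * ‖x‖ ^ 2} with hs
  have hsm : MeasurableSet s := measurableSet_lt measurable_const (by fun_prop)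
  -- the gradient of the convex function, up to the factor `2 c`
  set u : Space d → Space d := s.indicator id with hu
  have hum : Measurable u := measurable_id.indicator hsm
  have hu2 : MemLp (fun p : Space d × Space d => u p.1) 2 γ :=
    h.memLp_fst.of_le (hum.comp measurable_fst).aestronglyMeasurable
      (ae_of_all _ fun p => norm_indicator_le_norm_self id p.1)
  have hk1 : Integrable (fun p : Space d × Space d => form 1 (u p.1) p.1) γ :=
    integrable_form hu2 h.memLp_fst
  have hk2 : Integrable (fun p : Space d × Space d => form 1 (u p.1) p.2) γ :=
    integrable_form hu2 h.memLp_snd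
  have hk : Integrable (fun p : Space d × Space d =>
      2 * c * (form 1 (u p.1) p.2 - form 1 (u p.1) p.1)) γ := (hk2.sub hk1).const_mul _
  have hle : ∫ p, (max (c * ‖p.1‖ ^ 2 - R) 0 + 2 * c * (form 1 (u p.1) p.2 - form 1 (u p.1) p.1)) ∂γ
      ≤ ∫ p, max (c * ‖p.2‖ ^ 2 - R) 0 ∂γ := by
    refine integral_mono (hj1.add hk) hj2 fun p => ?_
    by_cases hp : p.1 ∈ s
    · have h1 : u p.1 = p.1 := by simp [hu, hp]
      have h2 : R < c * ‖p.1‖ ^ 2 := hp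
      have h3 := (le_abs_self _).trans (abs_form_one_le p.1 p.2)
      simp only [h1, form_one_self]
      rw [max_eq_left (by linarith)]
      refine le_trans ?_ (le_max_left _ _)
      nlinarith [mul_nonneg hc (sq_nonneg (‖p.1‖ - ‖p.2‖)), mul_le_mul_of_nonneg_left h3 hc]
    · have h1 : u p.1 = 0 := by simp [hu, hp]
      have h2 : c * ‖p.1‖ ^ 2 ≤ R := not_lt.1 hp
      have h3 : ∀ y : Space d, form 1 0 y = 0 := fun y => by rw [← bilin_apply]; simp
      simp only [h1, h3]
      rw [max_eq_right (by linarith)]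
      simp
  rw [integral_add hj1 hk, integral_const_mul] at hle
  have h0 : ∫ p : Space d × Space d, (form 1 (u p.1) p.2 - form 1 (u p.1) p.1) ∂γ = 0 := by
    rw [integral_sub hk2 hk1, h.integral_form hum hu2, sub_self]
  rw [h0] at hle
  linarith

theorem IsMartingalePlan.integral_sq_le {γ : Measure (Space d × Space d)}
    [IsFiniteMeasure γ] (h : IsMartingalePlan γ) :
    ∫ p, ‖p.1‖ ^ 2 ∂γ ≤ ∫ p, ‖p.2‖ ^ 2 ∂γ := by
  have := h.integral_truncated_sq_le zero_le_one (R := 0)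
  simpa [max_eq_left (sq_nonneg _)] using this

/-- The martingale condition can be tested on bounded continuous functions. -/
theorem isMartingalePlan_of_forall_integral_eq_zero {γ : Measure (Space d × Space d)}
    [IsFiniteMeasure γ] (h1 : MemLp Prod.fst 2 γ) (h2 : MemLp Prod.snd 2 γ)
    (h : ∀ (f : BoundedContinuousFunction (Space d) ℝ) (i : Fin d),
      ∫ p, f p.1 * (p.2 i - p.1 i) ∂γ = 0) : IsMartingalePlan γ := by
  refine ⟨h1, h2, fun s hs => ?_⟩
  have hint1 : Integrable (Prod.fst : Space d × Space d → Space d) γ :=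
    h1.integrable (by norm_num)
  have hint2 : Integrable (Prod.snd : Space d × Space d → Space d) γ :=
    h2.integrable (by norm_num)
  rw [← sub_eq_zero, ← integral_sub hint2.integrableOn hint1.integrableOn]
  ext i
  have hu : Integrable (fun p : Space d × Space d => p.2 i - p.1 i) γ :=
    (hint2.sub hint1).eval_piLp i
  have hum : Measurable fun p : Space d × Space d => p.2 i - p.1 i := by fun_prop
  -- compare the images of the positive and of the negative part of `y i - x i`
  have hfin : ∀ {w : Space d × Space d → ℝ}, Integrable w γ →
      IsFiniteMeasure (γ.withDensity fun p => ENNReal.ofReal (w p)) := fun hw =>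
    isFiniteMeasure_withDensity_ofReal hw.2
  have hu' : Integrable (fun p : Space d × Space d => -(p.2 i - p.1 i)) γ := hu.neg
  have hum' : Measurable fun p : Space d × Space d => -(p.2 i - p.1 i) := hum.neg
  have := hfin hu
  have := hfin hu'
  have hmap : ∀ (w : Space d × Space d → ℝ), Measurable w →
      ∀ f : BoundedContinuousFunction (Space d) ℝ,
      ∫ x, f x ∂((γ.withDensity fun p => ENNReal.ofReal (w p)).map Prod.fst)
        = ∫ p, max (w p) 0 * f p.1 ∂γ := by
    intro w hw f
    rw [integral_map measurable_fst.aemeasurable f.continuous.aestronglyMeasurable,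
      integral_withDensity_eq_integral_toReal_smul (by fun_prop) (by simp)]
    refine integral_congr_ae (ae_of_all _ fun p => ?_)
    simp only [smul_eq_mul]
    rw [ENNReal.toReal_ofReal']
  have heq : (γ.withDensity fun p => ENNReal.ofReal (p.2 i - p.1 i)).map Prod.fst
      = (γ.withDensity fun p => ENNReal.ofReal (-(p.2 i - p.1 i))).map Prod.fst := by
    have := Measure.isFiniteMeasure_map
      (γ.withDensity fun p => ENNReal.ofReal (p.2 i - p.1 i)) (Prod.fst (α := Space d) (β := Space d))
    have := Measure.isFiniteMeasure_map
      (γ.withDensity fun p => ENNReal.ofReal (-(p.2 i - p.1 i)))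
      (Prod.fst (α := Space d) (β := Space d))
    refine ext_of_forall_integral_eq_of_IsFiniteMeasure fun f => ?_
    have hbd : ∀ {w : Space d × Space d → ℝ}, Integrable w γ →
        Integrable (fun p => w p * f p.1) γ := fun hw =>
      hw.mul_bdd (c := ‖f‖) (f.continuous.comp continuous_fst).aestronglyMeasurable
        (ae_of_all _ fun p => f.norm_coe_le_norm p.1)
    rw [hmap _ hum, hmap _ hum', ← sub_eq_zero,
      ← integral_sub (hbd hu.pos_part) (hbd hu'.pos_part)]
    refine (integral_congr_ae (ae_of_all _ fun p => ?_)).trans (h f i)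
    simp only
    rw [← sub_mul, mul_comm]
    congr 1
    rcases le_total 0 (p.2 i - p.1 i) with h0 | h0
    · rw [max_eq_left h0, max_eq_right (by linarith), sub_zero]
    · rw [max_eq_right h0, max_eq_left (by linarith)]
      ring
  have hs' : MeasurableSet (Prod.fst ⁻¹' s : Set (Space d × Space d)) := measurable_fst hs
  have h3 := congrArg (fun μ => μ s) heq
  simp only [Measure.map_apply measurable_fst hs, withDensity_apply _ hs'] at h3
  have h4 : (∫ p in Prod.fst ⁻¹' s, (p.2 - p.1) ∂γ) i
      = ∫ p in Prod.fst ⁻¹' s, (p.2 i - p.1 i) ∂γ :=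
    eval_integral_piLp (fun j => (hint2.sub hint1).integrableOn.eval_piLp j) i
  rw [h4, integral_eq_lintegral_pos_part_sub_lintegral_neg_part hu.integrableOn, h3, sub_self]
  rfl

theorem isMartingalePlan_diag {ν : Measure (Space d)} (hν : MemLp id 2 ν) :
    IsMartingalePlan (ν.map fun y => (y, y)) :=
  (isMartingalePlan_map_iff measurable_id measurable_id).2 ⟨hν, hν, fun _ _ => rfl⟩

theorem exists_integral_truncated_sq_le {ν : Measure (Space d)} (hν : MemLp id 2 ν) {c : ℝ}
    (hc : 0 ≤ c) {ε : ℝ} (hε : 0 < ε) :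
    ∃ R, 0 ≤ R ∧ ∫ y, max (c * ‖y‖ ^ 2 - R) 0 ∂ν ≤ ε := by
  have hi : Integrable (fun y : Space d => c * ‖y‖ ^ 2) ν :=
    ((memLp_two_iff_integrable_sq_norm hν.1).1 hν).const_mul c
  have hlim : Filter.Tendsto (fun n : ℕ => ∫ y, max (c * ‖y‖ ^ 2 - n) 0 ∂ν) Filter.atTop
      (nhds (∫ _, (0 : ℝ) ∂ν)) := by
    refine tendsto_integral_of_dominated_convergence (fun y => c * ‖y‖ ^ 2)
      (fun n => by fun_prop) hi (fun n => ae_of_all _ fun y => ?_) (ae_of_all _ fun y => ?_)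
    · have h1 : 0 ≤ c * ‖y‖ ^ 2 := by positivity
      have h2 : (0 : ℝ) ≤ n := by positivity
      rw [Real.norm_of_nonneg (le_max_right _ _)]
      exact max_le (by linarith) h1
    · obtain ⟨N, hN⟩ := exists_nat_ge (c * ‖y‖ ^ 2)
      refine tendsto_const_nhds.congr' ?_
      filter_upwards [Filter.eventually_ge_atTop N] with n hn
      have : (N : ℝ) ≤ n := by exact_mod_cast hn
      rw [max_eq_right (by linarith)]
  rw [integral_zero] at hlim
  obtain ⟨n, hn⟩ := (hlim.eventually (ge_mem_nhds hε)).exists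
  exact ⟨n, by positivity, hn⟩

/-- The feasible plans, among the probability measures with the topology of weak convergence. -/
def planSet (ν : Measure (Space d)) : Set (ProbabilityMeasure (Space d × Space d)) :=
  {γ | (γ : Measure (Space d × Space d)) ∈ feasiblePlans ν}

theorem integral_comp_snd {ν : Measure (Space d)} {γ : Measure (Space d × Space d)}
    (h : γ.map Prod.snd = ν) {f : Space d → ℝ} (hf : Continuous f) :
    ∫ p, f p.2 ∂γ = ∫ y, f y ∂ν := by
  rw [← h, integral_map measurable_snd.aemeasurable hf.aestronglyMeasurable]

/-- The martingale condition passes to weak limits because the second moments are bounded along the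
set of plans, so that the functions `f(x) (y - x)` with `f` bounded are uniformly integrable. -/
theorem isClosed_planSet {ν : Measure (Space d)} [IsProbabilityMeasure ν] (hν : MemLp id 2 ν) :
    IsClosed (planSet ν) := by
  set M := ∫ y, ‖y‖ ^ 2 ∂ν with hM
  have hν2 : Integrable (fun y : Space d => ‖y‖ ^ 2) ν :=
    (memLp_two_iff_integrable_sq_norm hν.1).1 hν
  -- the condition on the second marginal and the bound of the second moment of the first one
  set K : Set (ProbabilityMeasure (Space d × Space d)) :=
    {γ | γ.map measurable_snd.aemeasurable = (⟨ν, inferInstance⟩ : ProbabilityMeasure (Space d))} ∩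
      ⋂ n : ℕ, {γ | ∫ p, min (‖p.1‖ ^ 2) (n : ℝ) ∂(γ : Measure (Space d × Space d)) ≤ M} with hK
  have hKcl : IsClosed K := by
    refine (isClosed_eq (ProbabilityMeasure.continuous_map continuous_snd) continuous_const).inter
      (isClosed_iInter fun n => isClosed_le ?_ continuous_const)
    exact ProbabilityMeasure.continuous_integral_boundedContinuousFunction
      (BoundedContinuousFunction.ofNormedAddCommGroup
        (fun p : Space d × Space d => min (‖p.1‖ ^ 2) (n : ℝ)) (by fun_prop) n fun p => by
          rw [Real.norm_of_nonneg (le_min (by positivity) (by positivity))]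
          exact min_le_right _ _)
  have hmarg : ∀ γ ∈ K, (γ : Measure (Space d × Space d)).map Prod.snd = ν := by
    intro γ hγ
    have := congrArg (fun μ : ProbabilityMeasure (Space d) => (μ : Measure (Space d))) hγ.1
    simpa using this
  have hsnd : ∀ γ ∈ K, MemLp Prod.snd 2 (γ : Measure (Space d × Space d)) := by
    intro γ hγ
    have h1 := hν
    rw [← hmarg γ hγ] at h1
    exact (memLp_map_measure_iff aestronglyMeasurable_id measurable_snd.aemeasurable).1 h1
  have hfst : ∀ γ ∈ K, MemLp Prod.fst 2 (γ : Measure (Space d × Space d)) := by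
    intro γ hγ
    rw [memLp_two_iff_integrable_sq_norm measurable_fst.aestronglyMeasurable]
    exact integrable_of_integral_min_le (by fun_prop) (fun p => by positivity)
      fun n => Set.mem_iInter.1 hγ.2 n
  have hfst2 : ∀ γ ∈ K, ∫ p, ‖p.1‖ ^ 2 ∂(γ : Measure (Space d × Space d)) ≤ M := by
    intro γ hγ
    have hi := (memLp_two_iff_integrable_sq_norm (hfst γ hγ).1).1 (hfst γ hγ)
    have hlim : Filter.Tendsto
        (fun n : ℕ => ∫ p, min (‖p.1‖ ^ 2) (n : ℝ) ∂(γ : Measure (Space d × Space d))) Filter.atTop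
        (nhds (∫ p, ‖p.1‖ ^ 2 ∂(γ : Measure (Space d × Space d)))) := by
      refine tendsto_integral_of_dominated_convergence (fun p => ‖p.1‖ ^ 2)
        (fun n => by fun_prop) hi (fun n => ae_of_all _ fun p => ?_) (ae_of_all _ fun p => ?_)
      · rw [Real.norm_of_nonneg (le_min (by positivity) (by positivity))]
        exact min_le_left _ _
      · obtain ⟨N, hN⟩ := exists_nat_ge (‖p.1‖ ^ 2)
        refine tendsto_const_nhds.congr' ?_
        filter_upwards [Filter.eventually_ge_atTop N] with n hn
        have : (N : ℝ) ≤ n := by exact_mod_cast hn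
        rw [min_eq_left (by linarith)]
    exact le_of_tendsto' hlim fun n => Set.mem_iInter.1 hγ.2 n
  have hsub : planSet ν ⊆ K := by
    intro γ hγ
    obtain ⟨-, h, hm⟩ := mem_feasiblePlans_iff.1 hγ
    have hi := (memLp_two_iff_integrable_sq_norm h.memLp_fst.1).1 h.memLp_fst
    refine ⟨Subtype.ext (by simpa using hm), Set.mem_iInter.2 fun n => ?_⟩
    refine le_trans (integral_mono_of_nonneg (ae_of_all _ fun p => ?_) hi
      (ae_of_all _ fun p => min_le_left _ _)) (h.integral_sq_le.trans (le_of_eq ?_))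
    · exact le_min (by positivity) (by positivity)
    · exact integral_comp_snd (f := fun y => ‖y‖ ^ 2) hm (by fun_prop)
  have heq : planSet ν = K ∩ ⋂ (f : BoundedContinuousFunction (Space d) ℝ) (i : Fin d), K ∩
      (fun γ : ProbabilityMeasure (Space d × Space d) =>
        ∫ p, f p.1 * (p.2 i - p.1 i) ∂(γ : Measure (Space d × Space d))) ⁻¹' {0} := by
    refine Set.Subset.antisymm (fun γ hγ => ?_) (fun γ hγ => ?_)
    · refine ⟨hsub hγ, Set.mem_iInter₂.2 fun f i => ⟨hsub hγ, ?_⟩⟩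
      obtain ⟨-, h, -⟩ := mem_feasiblePlans_iff.1 hγ
      -- the test function as a vector with one nonzero coordinate
      set u : Space d → Space d := fun x => f x • EuclideanSpace.single i (1 : ℝ) with hu
      have hum : Continuous u := f.continuous.smul continuous_const
      have hu2 : MemLp (fun p : Space d × Space d => u p.1) 2
          (γ : Measure (Space d × Space d)) := by
        refine MemLp.of_bound (hum.comp continuous_fst).aestronglyMeasurable ‖f‖
          (ae_of_all _ fun p => ?_)
        simp only [hu, norm_smul, PiLp.norm_single, norm_one, mul_one]
        exact f.norm_coe_le_norm p.1
      have hform : ∀ x y : Space d, form 1 (u x) y = f x * y i := by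
        intro x y
        rw [form_eq_inner, Matrix.one_mulVec, hu, real_inner_smul_left,
          EuclideanSpace.inner_single_left]
        simp
      have h1 := h.integral_form (S := 1) hum.measurable hu2
      have i1 := integrable_form (S := 1) hu2 h.memLp_fst
      have i2 := integrable_form (S := 1) hu2 h.memLp_snd
      simp only [hform] at h1 i1 i2
      simp only [Set.mem_preimage, Set.mem_singleton_iff, mul_sub]
      rw [integral_sub i2 i1, h1, sub_self]
    · refine mem_feasiblePlans_iff.2 ⟨inferInstance, ?_, hmarg γ hγ.1⟩
      exact isMartingalePlan_of_forall_integral_eq_zero (hfst γ hγ.1) (hsnd γ hγ.1)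
        fun f i => (Set.mem_iInter₂.1 hγ.2 f i).2
  rw [heq]
  refine hKcl.inter (isClosed_iInter fun f => isClosed_iInter fun i =>
    ContinuousOn.preimage_isClosed_of_isClosed ?_ hKcl isClosed_singleton)
  have hcoord : ∀ γ ∈ K, Integrable (fun p : Space d × Space d => p.2 i - p.1 i)
      (γ : Measure (Space d × Space d)) := fun γ hγ =>
    (((hsnd γ hγ).sub (hfst γ hγ)).integrable (by norm_num)).eval_piLp i
  have hfc : Continuous fun p : Space d × Space d => f p.1 :=
    f.continuous.comp continuous_fst
  refine continuousOn_integral (by fun_prop) (fun γ hγ => (hcoord γ hγ).bdd_mul (c := ‖f‖)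
    hfc.aestronglyMeasurable (ae_of_all _ fun p => f.norm_coe_le_norm p.1)) fun ε hε => ?_
  have hM0 : 0 ≤ M := integral_nonneg fun y => by positivity
  set C := ‖f‖ ^ 2 * M with hC
  have hC0 : 0 ≤ C := by positivity
  refine ⟨(C + 1) / ε, by positivity, fun γ hγ => ?_⟩
  have hi1 := (memLp_two_iff_integrable_sq_norm (hfst γ hγ).1).1 (hfst γ hγ)
  have hi2 := (memLp_two_iff_integrable_sq_norm (hsnd γ hγ).1).1 (hsnd γ hγ)
  have hsnd2 : ∫ p, ‖p.2‖ ^ 2 ∂(γ : Measure (Space d × Space d)) = M :=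
    integral_comp_snd (f := fun y => ‖y‖ ^ 2) (hmarg γ hγ) (by fun_prop)
  have hR : 0 < (C + 1) / ε := by positivity
  calc ∫ p, max (|f p.1 * (p.2 i - p.1 i)| - (C + 1) / ε) 0 ∂(γ : Measure (Space d × Space d))
      ≤ ∫ p, ε / (4 * (C + 1)) * (‖f‖ ^ 2 * (2 * ‖p.1‖ ^ 2 + 2 * ‖p.2‖ ^ 2))
          ∂(γ : Measure (Space d × Space d)) := by
        refine integral_mono_of_nonneg (ae_of_all _ fun p => le_max_right _ _)
          ((((hi1.const_mul 2).add (hi2.const_mul 2)).const_mul _).const_mul _)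
          (ae_of_all _ fun p => ?_)
        have h1 : |f p.1 * (p.2 i - p.1 i)| ≤ ‖f‖ * (‖p.2‖ + ‖p.1‖) := by
          rw [abs_mul]
          refine mul_le_mul (f.norm_coe_le_norm p.1) ?_ (abs_nonneg _) (norm_nonneg _)
          refine (abs_sub _ _).trans (add_le_add ?_ ?_)
          · exact PiLp.norm_apply_le p.2 i
          · exact PiLp.norm_apply_le p.1 i
        set a := |f p.1 * (p.2 i - p.1 i)| with ha
        have ha0 : 0 ≤ a := abs_nonneg _
        have h2 : a ^ 2 ≤ ‖f‖ ^ 2 * (2 * ‖p.1‖ ^ 2 + 2 * ‖p.2‖ ^ 2) := by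
          calc a ^ 2 ≤ (‖f‖ * (‖p.2‖ + ‖p.1‖)) ^ 2 := by gcongr
            _ = ‖f‖ ^ 2 * (‖p.2‖ + ‖p.1‖) ^ 2 := by ring
            _ ≤ _ := by
              gcongr
              nlinarith [sq_nonneg (‖p.2‖ - ‖p.1‖)]
        have h3 : a - (C + 1) / ε ≤ ε / (4 * (C + 1)) * a ^ 2 := by
          have : ε / (4 * (C + 1)) * a ^ 2 - a + (C + 1) / ε
              = ε / (4 * (C + 1)) * (a - 2 * ((C + 1) / ε)) ^ 2 := by
            field_simp
            ring
          have h4 : 0 ≤ ε / (4 * (C + 1)) * (a - 2 * ((C + 1) / ε)) ^ 2 := by positivity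
          linarith
        exact max_le (h3.trans (mul_le_mul_of_nonneg_left h2 (by positivity))) (by positivity)
    _ = ε / (4 * (C + 1)) * (‖f‖ ^ 2 *
          (2 * ∫ p, ‖p.1‖ ^ 2 ∂(γ : Measure (Space d × Space d)) + 2 * M)) := by
        rw [integral_const_mul, integral_const_mul, integral_add (hi1.const_mul 2)
          (hi2.const_mul 2), integral_const_mul, integral_const_mul, hsnd2]
    _ ≤ ε / (4 * (C + 1)) * (‖f‖ ^ 2 * (2 * M + 2 * M)) := by
        gcongr
        exact hfst2 γ hγ
    _ = ε * (C / (C + 1)) := by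
        rw [hC]
        field_simp
        ring
    _ ≤ ε := by
        have : C / (C + 1) ≤ 1 := (div_le_one (by positivity)).2 (by linarith)
        nlinarith

theorem isCompact_planSet {ν : Measure (Space d)} [IsProbabilityMeasure ν] (hν : MemLp id 2 ν) :
    IsCompact (planSet ν) := by
  rw [← (isClosed_planSet hν).closure_eq]
  refine isCompact_closure_of_isTightMeasureSet ?_
  refine isTightMeasureSet_of_tendsto_measure_norm_gt ?_
  set M := ∫ y, ‖y‖ ^ 2 ∂ν with hM
  have hM0 : 0 ≤ M := integral_nonneg fun y => by positivity
  have hbound : ∀ r : ℝ, 0 < r → ∀ γ : ProbabilityMeasure (Space d × Space d), γ ∈ planSet ν →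
      (γ : Measure (Space d × Space d)) {p | r < ‖p‖} ≤ ENNReal.ofReal (2 * M / r ^ 2) := by
    intro r hr γ hγ
    obtain ⟨-, h, hm⟩ := mem_feasiblePlans_iff.1 hγ
    have hi1 := (memLp_two_iff_integrable_sq_norm h.memLp_fst.1).1 h.memLp_fst
    have hi2 := (memLp_two_iff_integrable_sq_norm h.memLp_snd.1).1 h.memLp_snd
    have h1 := mul_meas_ge_le_integral_of_nonneg (μ := (γ : Measure (Space d × Space d)))
      (f := fun p : Space d × Space d => ‖p.1‖ ^ 2 + ‖p.2‖ ^ 2)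
      (ae_of_all _ fun p => by positivity) (hi1.add hi2) (r ^ 2)
    have h2 := h.integral_sq_le
    have h3 : ∫ p, ‖p.2‖ ^ 2 ∂(γ : Measure (Space d × Space d)) = M :=
      integral_comp_snd (f := fun y => ‖y‖ ^ 2) hm (by fun_prop)
    rw [integral_add hi1 hi2] at h1
    have h4 : (γ : Measure (Space d × Space d)).real {p | r < ‖p‖}
        ≤ (γ : Measure (Space d × Space d)).real {p | r ^ 2 ≤ ‖p.1‖ ^ 2 + ‖p.2‖ ^ 2} := by
      refine measureReal_mono fun p hp => ?_
      simp only [Set.mem_ofPred_eq] at hp ⊢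
      rw [Prod.norm_def, lt_max_iff] at hp
      rcases hp with hp | hp
      · have : r ^ 2 ≤ ‖p.1‖ ^ 2 := by gcongr
        nlinarith [sq_nonneg ‖p.2‖]
      · have : r ^ 2 ≤ ‖p.2‖ ^ 2 := by gcongr
        nlinarith [sq_nonneg ‖p.1‖]
    rw [← ofReal_measureReal]
    refine ENNReal.ofReal_le_ofReal (h4.trans ?_)
    rw [le_div_iff₀ (by positivity)]
    linarith
  have hlim : Filter.Tendsto (fun r : ℝ => ENNReal.ofReal (2 * M / r ^ 2)) Filter.atTop (nhds 0) := by
    rw [← ENNReal.ofReal_zero]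
    refine ENNReal.tendsto_ofReal ?_
    exact Filter.Tendsto.div_atTop tendsto_const_nhds (Filter.tendsto_pow_atTop (by norm_num))
  refine tendsto_of_tendsto_of_tendsto_of_le_of_le' tendsto_const_nhds hlim
    (Filter.Eventually.of_forall fun _ => zero_le) ?_
  filter_upwards [Filter.eventually_gt_atTop 0] with r hr
  refine iSup₂_le ?_
  rintro _ ⟨γ, hγ, rfl⟩
  exact hbound r hr γ hγ

/-- An optimal plan exists: the value is continuous on the compact set of plans, because the squares
`‖x‖²` are uniformly integrable by Jensen's inequality. -/
theorem exists_isOptimalPlan (S : Matrix (Fin d) (Fin d) ℝ) {ν : Measure (Space d)}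
    [IsProbabilityMeasure ν] (hν : MemLp id 2 ν) : ∃ γ, IsOptimalPlan S ν γ := by
  obtain ⟨c, hc0, hc⟩ := exists_abs_form_le S
  have hcont : ContinuousOn (fun γ : ProbabilityMeasure (Space d × Space d) =>
      ∫ p, form S p.1 p.1 ∂(γ : Measure (Space d × Space d))) (planSet ν) := by
    refine continuousOn_integral (continuous_form continuous_fst continuous_fst) (fun γ hγ => ?_)
      fun ε hε => ?_
    · have h := (mem_feasiblePlans_iff.1 hγ).2.1
      exact integrable_form h.memLp_fst h.memLp_fst
    · obtain ⟨R, hR0, hR⟩ := exists_integral_truncated_sq_le hν hc0 hε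
      refine ⟨R, hR0, fun γ hγ => ?_⟩
      obtain ⟨-, h, hm⟩ := mem_feasiblePlans_iff.1 hγ
      have hi := (memLp_two_iff_integrable_sq_norm h.memLp_fst.1).1 h.memLp_fst
      have h1 : ∫ p, max (c * ‖p.2‖ ^ 2 - R) 0 ∂(γ : Measure (Space d × Space d)) ≤ ε := by
        rw [integral_comp_snd (f := fun y => max (c * ‖y‖ ^ 2 - R) 0) hm (by fun_prop)]
        exact hR
      refine le_trans ?_ ((h.integral_truncated_sq_le hc0).trans h1)
      refine integral_mono_of_nonneg (ae_of_all _ fun p => le_max_right _ _)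
        ((hi.const_mul c).sub (integrable_const R)).pos_part (ae_of_all _ fun p => ?_)
      refine max_le_max (sub_le_sub_right ?_ R) le_rfl
      rw [sq]
      exact hc p.1 p.1
  have hdiag : IsProbabilityMeasure (ν.map fun y : Space d => (y, y)) :=
    Measure.isProbabilityMeasure_map (by fun_prop)
  have hne : (planSet ν).Nonempty := by
    have hmem : (ν.map fun y : Space d => (y, y)) ∈ feasiblePlans ν := by
      refine mem_feasiblePlans_iff.2 ⟨hdiag, isMartingalePlan_diag hν, ?_⟩
      rw [Measure.map_map measurable_snd (by fun_prop)]
      exact Measure.map_id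
    exact ⟨⟨_, hdiag⟩, hmem⟩
  obtain ⟨γ, hγ, hmax⟩ := (isCompact_planSet hν).exists_isMaxOn hne hcont
  refine ⟨γ, hγ, fun η hη => ?_⟩
  have hprob : IsProbabilityMeasure η := hη.1
  have h2 := (mem_feasiblePlans_iff.1 hη).2.1
  have h3 := hmax (show (⟨η, hprob⟩ : ProbabilityMeasure (Space d × Space d)) ∈ planSet ν from hη)
  have h4 := (mem_feasiblePlans_iff.1 hγ).2.1
  rw [h2.integral_form_fst, h4.integral_form_fst]
  exact mul_le_mul_of_nonneg_left h3 (by norm_num)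

end

/-! ### Optimality of the projection -/

section


variable {d : ℕ} {S : Matrix (Fin d) (Fin d) ℝ} {G : Set (Space d)}

theorem proj_eq_singleton_of_mem {x y : Space d} (hx : x ∈ proj S G y) (hy : y ∉ singularSet S G) :
    proj S G y = {x} ∧ projFun S G y = x := by
  have h : ∃ x, proj S G y = {x} := by
    by_contra h
    exact hy ⟨⟨x, hx⟩, h⟩
  have h1 := proj_eq_singleton_projFun h
  have h2 : x = projFun S G y := by rwa [h1] at hx
  exact ⟨by rw [h2, ← h1], h2.symm⟩

/-- There is no duality gap: the value of every optimal plan is at least the dual value. -/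
theorem IsOptimalPlan.extExpectation_le {m : ℕ} (hS : S ∈ symMatrices d m) {ν : Measure (Space d)}
    (hG : IsDualOptimal S ν G) {γ : Measure (Space d × Space d)} (hγ : IsOptimalPlan S ν γ) :
    extExpectation ν (fitzpatrick S G) ≤ (((1 / 2) * ∫ p, form S p.1 p.2 ∂γ : ℝ) : EReal) := by
  obtain ⟨F⟩ := exists_fundamentalSymmetry hS
  obtain ⟨hSh, -⟩ := hS
  have : IsProbabilityMeasure γ := hγ.1.1
  obtain ⟨-, h, hν⟩ := mem_feasiblePlans_iff.1 hγ.1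
  obtain ⟨H, hH, hle⟩ := hγ.exists_maximalMonotoneSet F hSh
  have h1 := h.extExpectation_le hle
  rw [hν] at h1
  exact (hG.2 H hH).trans h1

/-- An optimal plan is the image of its second marginal under the projection. -/
theorem IsOptimalPlan.ae_proj_eq {m : ℕ} (hS : S ∈ symMatrices d m) {ν : Measure (Space d)}
    (hG : IsDualOptimal S ν G) (hsing : ∀ᵐ y ∂ν, y ∉ singularSet S G)
    {γ : Measure (Space d × Space d)} (hγ : IsOptimalPlan S ν γ) :
    ∀ᵐ p ∂γ, proj S G p.2 = {p.1} ∧ projFun S G p.2 = p.1 := by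
  have hgap := hγ.extExpectation_le hS hG
  obtain ⟨F⟩ := exists_fundamentalSymmetry hS
  obtain ⟨hSh, -⟩ := hS
  have : IsProbabilityMeasure γ := hγ.1.1
  obtain ⟨-, h, hν⟩ := mem_feasiblePlans_iff.1 hγ.1
  rw [← hν] at hgap hsing
  filter_upwards [h.ae_mem_proj F hSh hG.1 hgap,
    ae_of_ae_map measurable_snd.aemeasurable hsing] with p hp hps
  exact proj_eq_singleton_of_mem hp hps

theorem IsOptimalPlan.eq_map {m : ℕ} (hS : S ∈ symMatrices d m) {ν : Measure (Space d)}
    (hG : IsDualOptimal S ν G) (hsing : ∀ᵐ y ∂ν, y ∉ singularSet S G)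
    {γ : Measure (Space d × Space d)} (hγ : IsOptimalPlan S ν γ) :
    γ = ν.map fun y => (projFun S G y, y) := by
  have hT : Measurable fun y => (projFun S G y, y) :=
    (measurable_projFun hG.1).prodMk measurable_id
  conv_rhs => rw [← hγ.1.2.2.1, Measure.map_map hT measurable_snd]
  conv_lhs => rw [← Measure.map_id (μ := γ)]
  refine Measure.map_congr ?_
  filter_upwards [hγ.ae_proj_eq hS hG hsing] with p hp
  simp [hp.2]

end

end BackwardTransport

theorem theorem5 {d m : ℕ} (S : Matrix (Fin d) (Fin d) ℝ)
    (hS : S ∈ BackwardTransport.symMatrices d m)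
    {Ω : Type*} [MeasurableSpace Ω] (P : Measure Ω) [IsProbabilityMeasure P]
    (Y : Ω → BackwardTransport.Space d) (hYm : Measurable Y) (hY : MemLp Y 2 P)
    (G : Set (BackwardTransport.Space d))
    (hG : BackwardTransport.IsDualOptimal S (P.map Y) G)
    (hsing : ∀ᵐ ω ∂P, Y ω ∉ BackwardTransport.singularSet S G)
    (X : Ω → BackwardTransport.Space d)
    (hX : X = fun ω => BackwardTransport.projFun S G (Y ω)) :
    (∀ᵐ ω ∂P, BackwardTransport.proj S G (Y ω) = {X ω}) ∧
    BackwardTransport.IsOptimalMap S P Y X ∧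
    (∀ Z : Ω → BackwardTransport.Space d, BackwardTransport.IsOptimalMap S P Y Z → Z =ᵐ[P] X) ∧
    BackwardTransport.IsOptimalPlan S (P.map Y) (P.map fun ω => (X ω, Y ω)) ∧
    (∀ γ : Measure (BackwardTransport.Space d × BackwardTransport.Space d),
      BackwardTransport.IsOptimalPlan S (P.map Y) γ → γ = P.map fun ω => (X ω, Y ω)) := by
  open BackwardTransport in
  have hf := measurable_projFun hG.1
  have hXm : Measurable X := by
    rw [hX]
    exact hf.comp hYm
  have hprob : IsProbabilityMeasure (P.map Y) := Measure.isProbabilityMeasure_map hYm.aemeasurable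
  have hν : MemLp id 2 (P.map Y) :=
    (memLp_map_measure_iff aestronglyMeasurable_id hYm.aemeasurable).2 hY
  obtain ⟨γ₀, hγ₀⟩ := exists_isOptimalPlan S hν
  have hsing' : ∀ᵐ y ∂(P.map Y), y ∉ singularSet S G :=
    (ae_map_iff hYm.aemeasurable (measurableSet_singularSet hG.1).compl).2 hsing
  have hlaw : (P.map Y).map (fun y => (projFun S G y, y)) = P.map fun ω => (X ω, Y ω) := by
    have hT : Measurable fun y => (projFun S G y, y) := hf.prodMk measurable_id
    rw [Measure.map_map hT hYm, hX]
    rfl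
  have huniq : ∀ γ, IsOptimalPlan S (P.map Y) γ → γ = P.map fun ω => (X ω, Y ω) := fun γ hγ => by
    rw [hγ.eq_map hS hG hsing', hlaw]
  have hopt : IsOptimalPlan S (P.map Y) (P.map fun ω => (X ω, Y ω)) := huniq γ₀ hγ₀ ▸ hγ₀
  have hT : Measurable fun ω => (X ω, Y ω) := hXm.prodMk hYm
  have hplan : ∀ Z ∈ feasibleMaps P Y, (P.map fun ω => (Z ω, Y ω)) ∈ feasiblePlans (P.map Y) :=
    fun Z hZ => (map_mem_feasiblePlans_iff hZ.1 hYm hY).2 ⟨hZ.2.1, hZ.2.2.2⟩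
  have hXfeas : X ∈ feasibleMaps P Y := by
    obtain ⟨h1, h2⟩ := (map_mem_feasiblePlans_iff hXm hYm hY).1 hopt.1
    exact ⟨hXm, h1, ⟨projFun S G, hf, by rw [hX]⟩, h2⟩
  refine ⟨?_, ⟨hXfeas, fun Z hZ => ?_⟩, fun Z hZ => ?_, hopt, huniq⟩
  · filter_upwards [ae_of_ae_map hT.aemeasurable (hopt.ae_proj_eq hS hG hsing')] with ω hω
    exact hω.1
  · have := hopt.2 _ (hplan Z hZ)
    rwa [integral_form_map hZ.1 hYm, integral_form_map hXm hYm] at this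
  · have hZopt : IsOptimalPlan S (P.map Y) (P.map fun ω => (Z ω, Y ω)) := by
      refine ⟨hplan Z hZ.1, fun η hη => (hopt.2 η hη).trans ?_⟩
      rw [integral_form_map hZ.1.1 hYm, integral_form_map hXm hYm]
      exact hZ.2 X hXfeas
    filter_upwards [ae_of_ae_map (hZ.1.1.prodMk hYm).aemeasurable
      (hZopt.ae_proj_eq hS hG hsing')] with ω hω
    rw [hX]
    exact hω.2.symm
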